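/- Let $k$ be an algebraically closed field of characteristic $0$, let $V=k^r$, $W=(k^\times)^s$, $Y=V\times W$, and let $G=(k^\times)^m$ be an algebraic torus acting diagonally on $Y$, that is, $g\cdot(y_1,\dots,y_{r+s})=(\eta_1(g)y_1,\dots,\eta_{r+s}(g)y_{r+s})$ for characters $\eta_1,\dots,\eta_{r+s}$ of the algebraic group $G$. Let $\mathcal D(V)$ and $\mathcal D(Y)$ be the rings of $k$-linear differential operators on the algebras $\mathcal O(V)$ and $\mathcal O(Y)$ of regular functions, with the induced actions of $G$. A $k$-algebra $R$ is said to have enough simple finite dimensional modules if the intersection of the annihilators in $R$ of all simple finite dimensional $R$-modules is zero. Theorem B. Assume that $G$ acts transitively on $W$. Let $w\in W$, let $H$ be the stabilizer of $w$ in $G$, and let $H^\circ$ be the connected component of the identity in $H$. The following conditions are equivalent: (1) $V^{H^\circ}=0$; (2) $\mathcal D(V)^{H^\circ}$ has enough simple finite dimensional modules; (3) $\mathcal D(Y)^G$ has a nonzero finite dimensional module; (4) $\mathcal D(Y)^G$ has enough simple finite dimensional modules. -/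

import Mathlib

universe u

noncomputable section

namespace TorusDiff

section DifferentialOperators

variable (k A : Type u) [Field k] [CommRing A] [Algebra k A]

/-- `IsDiffOp k A p θ`: the `k`-linear endomorphism `θ` of the commutative `k`-algebra `A` is a
differential operator of order at most `p` in the sense of Grothendieck: the operators of order
at most `0` are those commuting with all multiplications by elements of `A`, and `θ` has order at
most `p + 1` if all commutators of `θ` with such multiplications have order at most `p`. -/
def IsDiffOp : ℕ → Module.End k A → Prop
  | 0, θ => ∀ a : A, θ * LinearMap.mulLeft k a - LinearMap.mulLeft k a * θ = 0
  | p + 1, θ => ∀ a : A, IsDiffOp p (θ * LinearMap.mulLeft k a - LinearMap.mulLeft k a * θ)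

variable {k A}

theorem IsDiffOp.zero (p : ℕ) : IsDiffOp k A p 0 := by
  induction p with
  | zero => intro a; simp
  | succ p ih => intro a; simpa using ih

theorem IsDiffOp.succ {p : ℕ} {θ : Module.End k A} (h : IsDiffOp k A p θ) :
    IsDiffOp k A (p + 1) θ := by
  induction p generalizing θ with
  | zero => intro a; rw [h a]; exact IsDiffOp.zero 0
  | succ p ih => intro a; exact ih (h a)

theorem IsDiffOp.mono {p q : ℕ} (hpq : p ≤ q) {θ : Module.End k A} (h : IsDiffOp k A p θ) :
    IsDiffOp k A q θ := by
  induction hpq with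
  | refl => exact h
  | step _ ih => exact ih.succ

theorem IsDiffOp.add {p : ℕ} {θ φ : Module.End k A} (h : IsDiffOp k A p θ)
    (h' : IsDiffOp k A p φ) : IsDiffOp k A p (θ + φ) := by
  induction p generalizing θ φ with
  | zero =>
    intro a
    have e : (θ + φ) * LinearMap.mulLeft k a - LinearMap.mulLeft k a * (θ + φ) =
        (θ * LinearMap.mulLeft k a - LinearMap.mulLeft k a * θ) +
        (φ * LinearMap.mulLeft k a - LinearMap.mulLeft k a * φ) := by noncomm_ring
    rw [e, h a, h' a, add_zero]
  | succ p ih =>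
    intro a
    have e : (θ + φ) * LinearMap.mulLeft k a - LinearMap.mulLeft k a * (θ + φ) =
        (θ * LinearMap.mulLeft k a - LinearMap.mulLeft k a * θ) +
        (φ * LinearMap.mulLeft k a - LinearMap.mulLeft k a * φ) := by noncomm_ring
    rw [e]
    exact ih (h a) (h' a)

theorem IsDiffOp.mul {n : ℕ} : ∀ {p q : ℕ}, p + q = n → ∀ {θ φ : Module.End k A},
    IsDiffOp k A p θ → IsDiffOp k A q φ → IsDiffOp k A (p + q) (θ * φ) := by
  induction n with
  | zero =>
    intro p q hpq θ φ h h'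
    obtain ⟨rfl, rfl⟩ : p = 0 ∧ q = 0 := by omega
    intro a
    have e : θ * φ * LinearMap.mulLeft k a - LinearMap.mulLeft k a * (θ * φ) =
        θ * (φ * LinearMap.mulLeft k a - LinearMap.mulLeft k a * φ) +
        (θ * LinearMap.mulLeft k a - LinearMap.mulLeft k a * θ) * φ := by
      simp only [mul_sub, sub_mul, mul_assoc]; abel
    rw [e, h a, h' a]; simp
  | succ n ih =>
    intro p q hpq θ φ h h'
    rw [hpq]
    intro a
    have e : θ * φ * LinearMap.mulLeft k a - LinearMap.mulLeft k a * (θ * φ) =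
        θ * (φ * LinearMap.mulLeft k a - LinearMap.mulLeft k a * φ) +
        (θ * LinearMap.mulLeft k a - LinearMap.mulLeft k a * θ) * φ := by
      simp only [mul_sub, sub_mul, mul_assoc]; abel
    rw [e]
    refine IsDiffOp.add ?_ ?_
    · cases q with
      | zero => rw [h' a, mul_zero]; exact IsDiffOp.zero n
      | succ q =>
        have := ih (p := p) (q := q) (by omega) h (h' a)
        rwa [show p + q = n by omega] at this
    · cases p with
      | zero => rw [h a, zero_mul]; exact IsDiffOp.zero n
      | succ p =>
        have := ih (p := p) (q := q) (by omega) (h a) h'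
        rwa [show p + q = n by omega] at this

variable (k A)

/-- The ring of `k`-linear differential operators of the commutative `k`-algebra `A`. -/
def diffOps : Subalgebra k (Module.End k A) where
  carrier := {θ | ∃ p, IsDiffOp k A p θ}
  mul_mem' := by
    rintro θ φ ⟨p, h⟩ ⟨q, h'⟩
    exact ⟨p + q, IsDiffOp.mul rfl h h'⟩
  add_mem' := by
    rintro θ φ ⟨p, h⟩ ⟨q, h'⟩
    exact ⟨max p q, (h.mono (le_max_left p q)).add (h'.mono (le_max_right p q))⟩
  algebraMap_mem' c := by
    refine ⟨0, fun a => ?_⟩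
    rw [Algebra.commutes, sub_self]

variable {k A}

/-- The differential operators `θ` of `A` which are invariant under all automorphisms `γ ∈ Γ`,
that is `γ ∘ θ ∘ γ⁻¹ = θ`, or in other words `θ ∘ γ = γ ∘ θ`. -/
def invariantDiffOps (Γ : Set (A ≃ₐ[k] A)) : Subalgebra k (Module.End k A) :=
  diffOps k A ⊓ Subalgebra.centralizer k ((fun γ => γ.toLinearMap) '' Γ)

end DifferentialOperators

section FiniteDimensionalModules

variable (k R : Type u) [Field k] [Ring R] [Algebra k R]

/-- The `k`-algebra `R` has enough simple finite dimensional modules: the intersection of the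
annihilators of all simple finite dimensional `R`-modules is zero. -/
def HasEnoughSimpleFD : Prop :=
  ∀ x : R,
    (∀ (M : Type u) [AddCommGroup M] [Module k M] [Module R M] [IsScalarTower k R M],
      IsSimpleModule R M → FiniteDimensional k M → x ∈ Module.annihilator R M) → x = 0

/-- The `k`-algebra `R` has a nonzero finite dimensional module. -/
def HasNonzeroFD : Prop :=
  ∃ (M : Type u) (_ : AddCommGroup M) (_ : Module k M) (_ : Module R M)
    (_ : IsScalarTower k R M), FiniteDimensional k M ∧ Nontrivial M

end FiniteDimensionalModules

section Varieties

variable {k : Type u} [Field k] {X : Type u} {ι : Type}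

/-- The algebra of regular functions on an affine variety with set of points `X` and coordinate
functions `c i : X → k`: the algebra of functions on `X` generated by the coordinates. -/
def regular (c : ι → X → k) : Subalgebra k (X → k) :=
  Algebra.adjoin k (Set.range c)

/-- The Zariski topology on `X`: the nonvanishing loci of regular functions form a basis. -/
abbrev zariski (c : ι → X → k) : TopologicalSpace X :=
  TopologicalSpace.generateFrom {U | ∃ f ∈ regular c, U = {x | f x ≠ 0}}

/-- The `k`-algebra `O(X)` of regular functions, as a type. -/
def RegularFunctions (c : ι → X → k) : Type u := regular c

instance (c : ι → X → k) : CommRing (RegularFunctions c) :=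
  inferInstanceAs (CommRing (regular c))

instance (c : ι → X → k) : Algebra k (RegularFunctions c) :=
  inferInstanceAs (Algebra k (regular c))

theorem comp_mem_regular (c : ι → X → k) (φ : X → X) (hφ : ∀ i, c i ∘ φ ∈ regular c)
    {f : X → k} (hf : f ∈ regular c) : f ∘ φ ∈ regular c := by
  refine Algebra.adjoin_induction (p := fun f _ => f ∘ φ ∈ regular c) ?_ ?_ ?_ ?_ hf
  · rintro _ ⟨i, rfl⟩
    exact hφ i
  · intro b
    exact (regular c).algebraMap_mem b
  · intro f g _ _ h h'
    exact (regular c).add_mem h h'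
  · intro f g _ _ h h'
    exact (regular c).mul_mem h h'

/-- The pullback `f ↦ f ∘ φ` of regular functions along an automorphism `φ : X → X` with
inverse `ψ`. -/
def pullback (c : ι → X → k) (φ ψ : X → X) (hφ : ∀ i, c i ∘ φ ∈ regular c)
    (hψ : ∀ i, c i ∘ ψ ∈ regular c) (h : ∀ x, φ (ψ x) = x) (h' : ∀ x, ψ (φ x) = x) :
    RegularFunctions c ≃ₐ[k] RegularFunctions c where
  toFun f := ⟨f.1 ∘ φ, comp_mem_regular c φ hφ f.2⟩
  invFun f := ⟨f.1 ∘ ψ, comp_mem_regular c ψ hψ f.2⟩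
  left_inv f := Subtype.ext (funext fun x => congrArg f.1 (h x))
  right_inv f := Subtype.ext (funext fun x => congrArg f.1 (h' x))
  map_mul' _ _ := rfl
  map_add' _ _ := rfl
  commutes' _ := rfl

end Varieties

/-- The points of the torus `(kˣ)^m`. -/
abbrev Torus (k : Type u) [Field k] (m : ℕ) : Type u := Fin m → kˣ

/-- The points of `Y = k^r × (kˣ)^s`. -/
abbrev YPoints (k : Type u) [Field k] (r s : ℕ) : Type u := (Fin r → k) × (Fin s → kˣ)

section Coordinates

variable (k : Type u) [Field k]

/-- The coordinates on `(kˣ)^m` and their inverses. -/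
def torusCoord (m : ℕ) : Fin m ⊕ Fin m → Torus k m → k :=
  Sum.elim (fun i g => (g i : k)) (fun i g => ((g i)⁻¹ : kˣ))

/-- The coordinates on `V = k^r`. -/
def vCoord (r : ℕ) : Fin r → (Fin r → k) → k := fun i v => v i

/-- The coordinates `Q_1, …, Q_{r+s}` on `Y = k^r × (kˣ)^s`, and the inverses of the last `s`. -/
def yCoord (r s : ℕ) : Fin r ⊕ (Fin s ⊕ Fin s) → YPoints k r s → k :=
  Sum.elim (fun i y => y.1 i) (Sum.elim (fun j y => (y.2 j : k)) (fun j y => ((y.2 j)⁻¹ : kˣ)))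

end Coordinates

/-- A diagonal action of the torus `G = (kˣ)^m` on `Y = k^r × (kˣ)^s`: it is given by weights,
which are characters of the algebraic group `G`, that is, group homomorphisms `G → kˣ` which are
regular functions on `G`. -/
structure DiagonalAction (k : Type u) [Field k] (m r s : ℕ) where
  /-- the weights on `V = k^r` -/
  weightV : Fin r → (Torus k m →* kˣ)
  /-- the weights on `W = (kˣ)^s` -/
  weightW : Fin s → (Torus k m →* kˣ)
  regularV : ∀ i, (fun g => (weightV i g : k)) ∈ regular (torusCoord k m)
  regularW : ∀ j, (fun g => (weightW j g : k)) ∈ regular (torusCoord k m)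

namespace DiagonalAction

variable {k : Type u} [Field k] {m r s : ℕ} (a : DiagonalAction k m r s)

/-- The action of `g ∈ G` on `V`. -/
def actV (g : Torus k m) (v : Fin r → k) : Fin r → k := fun i => (a.weightV i g : k) * v i

/-- The action of `g ∈ G` on `W`. -/
def actW (g : Torus k m) (w : Fin s → kˣ) : Fin s → kˣ := fun j => a.weightW j g * w j

/-- The action of `g ∈ G` on `Y = V × W`. -/
def actY (g : Torus k m) (y : YPoints k r s) : YPoints k r s := (a.actV g y.1, a.actW g y.2)

/-- `G` acts transitively on `W`. -/
def TransitiveOnW : Prop := ∀ w w' : Fin s → kˣ, ∃ g : Torus k m, a.actW g w = w'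

/-- The stabilizer in `G` of `w ∈ W`. -/
def stabilizer (w : Fin s → kˣ) : Subgroup (Torus k m) where
  carrier := {g | a.actW g w = w}
  one_mem' := by funext j; simp [actW]
  mul_mem' := by
    intro g h hg hh
    funext j
    have h1 := congrFun hg j
    have h2 := congrFun hh j
    simp only [actW, mul_eq_right] at h1 h2
    simp [actW, h1, h2]
  inv_mem' := by
    intro g hg
    funext j
    have h1 := congrFun hg j
    simp only [actW, mul_eq_right] at h1
    simp [actW, h1]

/-- The connected component `H°` of the identity in the stabilizer `H` of `w`, for the Zariski
topology. -/
def stabilizerIdentityComponent (w : Fin s → kˣ) : Set (Torus k m) :=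
  @connectedComponentIn (Torus k m) (zariski (torusCoord k m)) (a.stabilizer w) 1

/-- The subspace of `V` fixed by all elements of `S ⊆ G`. -/
def fixedV (S : Set (Torus k m)) : Submodule k (Fin r → k) where
  carrier := {v | ∀ g ∈ S, a.actV g v = v}
  zero_mem' := by intro g _; funext i; simp [actV]
  add_mem' := by
    intro v v' hv hv' g hg
    funext i
    have h1 := congrFun (hv g hg) i
    have h2 := congrFun (hv' g hg) i
    simp only [actV] at h1 h2
    simp only [actV, Pi.add_apply, mul_add, h1, h2]
  smul_mem' := by
    intro b v hv g hg
    funext i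
    have h1 := congrFun (hv g hg) i
    simp only [actV] at h1
    simp only [actV, Pi.smul_apply, smul_eq_mul]
    rw [mul_left_comm, h1]

theorem actV_regular (g : Torus k m) (i : Fin r) :
    vCoord k r i ∘ a.actV g ∈ regular (vCoord k r) :=
  (regular (vCoord k r)).smul_mem (Algebra.subset_adjoin ⟨i, rfl⟩) (a.weightV i g : k)

theorem actY_regular (g : Torus k m) (i : Fin r ⊕ (Fin s ⊕ Fin s)) :
    yCoord k r s i ∘ a.actY g ∈ regular (yCoord k r s) := by
  rcases i with i | j | j
  · exact (regular (yCoord k r s)).smul_mem (Algebra.subset_adjoin ⟨Sum.inl i, rfl⟩)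
      (a.weightV i g : k)
  · exact (regular (yCoord k r s)).smul_mem (Algebra.subset_adjoin ⟨Sum.inr (Sum.inl j), rfl⟩)
      (a.weightW j g : k)
  · have h := (regular (yCoord k r s)).smul_mem
      (Algebra.subset_adjoin ⟨Sum.inr (Sum.inr j), rfl⟩) (((a.weightW j g)⁻¹ : kˣ) : k)
    convert h using 1
    funext y
    simp [yCoord, actY, actW, mul_comm]

theorem actV_inv (g h : Torus k m) (hg : g * h = 1) (v : Fin r → k) :
    a.actV g (a.actV h v) = v := by
  funext i
  simp only [actV]
  rw [← mul_assoc, ← Units.val_mul, ← map_mul, hg, map_one, Units.val_one, one_mul]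

theorem actW_inv (g h : Torus k m) (hg : g * h = 1) (w : Fin s → kˣ) :
    a.actW g (a.actW h w) = w := by
  funext j
  simp only [actW]
  rw [← mul_assoc, ← map_mul, hg, map_one, one_mul]

theorem actY_inv (g h : Torus k m) (hg : g * h = 1) (y : YPoints k r s) :
    a.actY g (a.actY h y) = y :=
  Prod.ext (a.actV_inv g h hg y.1) (a.actW_inv g h hg y.2)

/-- The action `(g · f)(v) = f(g v)` of `g ∈ G` on `O(V)`. -/
def translateV (g : Torus k m) :
    RegularFunctions (vCoord k r) ≃ₐ[k] RegularFunctions (vCoord k r) :=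
  pullback _ (a.actV g) (a.actV g⁻¹) (a.actV_regular g) (a.actV_regular g⁻¹)
    (a.actV_inv g g⁻¹ (mul_inv_cancel g)) (a.actV_inv g⁻¹ g (inv_mul_cancel g))

/-- The action `(g · f)(y) = f(g y)` of `g ∈ G` on `O(Y)`. -/
def translateY (g : Torus k m) :
    RegularFunctions (yCoord k r s) ≃ₐ[k] RegularFunctions (yCoord k r s) :=
  pullback _ (a.actY g) (a.actY g⁻¹) (a.actY_regular g) (a.actY_regular g⁻¹)
    (a.actY_inv g g⁻¹ (mul_inv_cancel g)) (a.actY_inv g⁻¹ g (inv_mul_cancel g))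

/-- The ring `D(V)^S` of differential operators on `V` invariant under all elements of
`S ⊆ G`. -/
def diffOpsV (S : Set (Torus k m)) :
    Subalgebra k (Module.End k (RegularFunctions (vCoord k r))) :=
  invariantDiffOps (a.translateV '' S)

/-- The ring `D(Y)^S` of differential operators on `Y` invariant under all elements of
`S ⊆ G`. -/
def diffOpsY (S : Set (Torus k m)) :
    Subalgebra k (Module.End k (RegularFunctions (yCoord k r s))) :=
  invariantDiffOps (a.translateY '' S)

end DiagonalAction

end TorusDiff

end

/-! Both coordinate rings have a basis of monomials `x^μ` with `μ` in an orthant of `ℤ^I`. The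
coefficient of `x^(μ+l)` in `θ x^μ` is polynomial in `μ` for every differential operator `θ`,
because a commutator with a coordinate acts on it as a finite difference. It therefore extends to
all of `ℤ^I`, so differential operators act on the span of all Laurent monomials (`entry`,
`IsMonomialBasis.entry_mul`), and a nonnegative exponent of a polynomial coordinate never becomes
negative. Invariance under a set of torus elements means that all degrees `l` lie in the lattice `Λ`
of trivial weights. Hence a coset of `Λ` cut down by a sign pattern (`IsCell`) spans a subquotient;
if the cell is finite and nonempty, all matrices occur on it and it is a simple module.

If an integral functional vanishing on `Λ` is nonzero at exactly the polynomial coordinates, its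
signs single out a pattern whose cells are finite, provided elements of `Λ` are determined by their
polynomial coordinates. These cells meet a Zariski dense set of exponents, so an operator killing
all of them is zero: `IsMonomialBasis.hasEnoughSimpleFD`. If instead `Λ` contains an `l` with `l i =
N > 0` and no other polynomial coordinate, then `x^l` and `x^(-l) x_i^N ∂_i^N` are ladder operators
for `x_i ∂_i`. Every eigenvalue can be raised or lowered forever, so no nonzero finite dimensional
module exists: `IsMonomialBasis.not_hasNonzeroFD`.

The torus geometry decides which case occurs. A weight on `V` is trivial on `H°` exactly when a
positive multiple of it is an integral combination of the weights on `W`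
(`DiagonalAction.weightV_trivial_iff`). If no weight is, one cocharacter kills the weights on `W`
and pairs nontrivially with every weight on `V` (`exists_integral_functional`), and it supplies the
functional for both `V` and `Y`. If some weight is, the relation supplies the element `l`. -/

noncomputable section

namespace TorusDiff

/-! ### Polynomial functions on a lattice. -/

section PolynomialFunctions

variable {k : Type u} [Field k] {I : Type}

/-- A function on the lattice `ℤ^I` which is given by a polynomial. -/
def IsPoly (g : (I → ℤ) → k) : Prop :=
  ∃ F : MvPolynomial I k, ∀ μ, g μ = MvPolynomial.eval (fun i => (μ i : k)) F

theorem IsPoly.const (c : k) : IsPoly (fun _ : I → ℤ => c) :=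
  ⟨MvPolynomial.C c, fun μ => by simp⟩

theorem IsPoly.coord (i : I) : IsPoly (fun μ : I → ℤ => (μ i : k)) :=
  ⟨MvPolynomial.X i, fun μ => by simp⟩

theorem IsPoly.add {f g : (I → ℤ) → k} (hf : IsPoly f) (hg : IsPoly g) :
    IsPoly (fun μ => f μ + g μ) := by
  obtain ⟨F, hF⟩ := hf
  obtain ⟨G, hG⟩ := hg
  exact ⟨F + G, fun μ => by simp [hF, hG]⟩

theorem IsPoly.mul {f g : (I → ℤ) → k} (hf : IsPoly f) (hg : IsPoly g) :
    IsPoly (fun μ => f μ * g μ) := by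
  obtain ⟨F, hF⟩ := hf
  obtain ⟨G, hG⟩ := hg
  exact ⟨F * G, fun μ => by simp [hF, hG]⟩

theorem IsPoly.pow {f : (I → ℤ) → k} (hf : IsPoly f) (n : ℕ) : IsPoly (fun μ => f μ ^ n) := by
  obtain ⟨F, hF⟩ := hf
  exact ⟨F ^ n, fun μ => by simp [hF]⟩

theorem IsPoly.smul {f : (I → ℤ) → k} (c : k) (hf : IsPoly f) : IsPoly (fun μ => c * f μ) :=
  (IsPoly.const c).mul hf

theorem IsPoly.sub {f g : (I → ℤ) → k} (hf : IsPoly f) (hg : IsPoly g) :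
    IsPoly (fun μ => f μ - g μ) := by
  simpa [sub_eq_add_neg] using hf.add (hg.smul (-1))

theorem IsPoly.sum {ι : Type*} (s : Finset ι) {f : ι → (I → ℤ) → k} (hf : ∀ i, IsPoly (f i)) :
    IsPoly (fun μ => ∑ i ∈ s, f i μ) := by
  choose F hF using hf
  exact ⟨∑ i ∈ s, F i, fun μ => by simp [hF]⟩

theorem IsPoly.prod {ι : Type*} (s : Finset ι) {f : ι → (I → ℤ) → k} (hf : ∀ i, IsPoly (f i)) :
    IsPoly (fun μ => ∏ i ∈ s, f i μ) := by
  choose F hF using hf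
  exact ⟨∏ i ∈ s, F i, fun μ => by simp [hF]⟩

theorem IsPoly.polynomial_coord (q : Polynomial k) (j : I) :
    IsPoly (fun μ : I → ℤ => q.eval (μ j : k)) :=
  by
  simp only [Polynomial.eval_eq_sum_range]
  exact IsPoly.sum _ fun n => ((IsPoly.coord j).pow n).smul _

theorem IsPoly.comp_affine {f : (I → ℤ) → k} (hf : IsPoly f) (a : (I → ℤ) → (I → ℤ))
    (ha : ∀ i, IsPoly (fun μ => (a μ i : k))) : IsPoly (fun μ => f (a μ)) := by
  obtain ⟨F, hF⟩ := hf
  choose A hA using ha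
  refine ⟨MvPolynomial.bind₁ A F, fun μ => ?_⟩
  change f (a μ) = _
  rw [hF, ← MvPolynomial.coe_aeval_eq_eval, ← MvPolynomial.coe_aeval_eq_eval]
  simp only [RingHom.coe_coe, MvPolynomial.aeval_bind₁]
  congr 2
  funext i
  exact hA i μ

theorem IsPoly.shift {f : (I → ℤ) → k} (hf : IsPoly f) (κ : I → ℤ) :
    IsPoly (fun μ => f (μ + κ)) :=
  hf.comp_affine (fun μ => μ + κ) fun i => by
    simpa using (IsPoly.coord i).add (IsPoly.const (κ i : k))

theorem IsPoly.comp_update [DecidableEq I] {f : (I → ℤ) → k} (hf : IsPoly f) (i : I) (c : ℤ) :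
    IsPoly (fun μ => f (Function.update μ i c)) :=
  hf.comp_affine _ fun j => by
    by_cases h : j = i
    · subst h; simpa using IsPoly.const (c : k)
    · simpa [h] using IsPoly.coord j

/-- A polynomial function which vanishes on a product of infinite sets vanishes. -/
theorem IsPoly.eq_zero_of_pi [CharZero k] {f : (I → ℤ) → k} (hf : IsPoly f)
    (s : I → Set ℤ) (hs : ∀ i, (s i).Infinite) (h : ∀ μ, (∀ i, μ i ∈ s i) → f μ = 0) (μ : I → ℤ) :
    f μ = 0 := by
  obtain ⟨F, hF⟩ := hf
  have : F = 0 := by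
    refine MvPolynomial.funext_set (fun i => ((↑) : ℤ → k) '' s i)
      (fun i => (hs i).image Int.cast_injective.injOn) fun x hx => ?_
    have hx' : ∀ i, ∃ n ∈ s i, (n : k) = x i := fun i => hx i trivial
    choose ν hν hνx using hx'
    have := hF ν
    rw [h ν hν] at this
    simp only [hνx] at this
    rw [← this, map_zero]
  rw [hF, this, map_zero]

end PolynomialFunctions

/-! ### Functions on an orthant with polynomial differences. -/

section Orthant

variable {I : Type}

/-- The integral points whose coordinates in `P` are nonnegative. -/
def orthant (P : I → Prop) : AddSubmonoid (I → ℤ) where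
  carrier := {μ | ∀ i, P i → 0 ≤ μ i}
  zero_mem' _ _ := le_rfl
  add_mem' h h' i hi := add_nonneg (h i hi) (h' i hi)

theorem single_mem_orthant [DecidableEq I] {P : I → Prop} (i : I) :
    Pi.single i 1 ∈ orthant P := by
  intro j _
  by_cases h : j = i
  · subst h; simp
  · simp [h]

variable {k : Type u} [Field k] [CharZero k]

/-- An orthant contains a product of infinite sets, so it is Zariski dense. This is how identities
checked on genuine monomials pass to all Laurent exponents. -/
theorem IsPoly.eq_of_orthant {P : I → Prop} {f g : (I → ℤ) → k} (hf : IsPoly f) (hg : IsPoly g)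
    (h : ∀ μ ∈ orthant P, f μ = g μ) (μ : I → ℤ) : f μ = g μ :=
  sub_eq_zero.1 <| (hf.sub hg).eq_zero_of_pi (fun _ => Set.Ici 0) (fun _ => Set.Ici_infinite 0)
    (fun ν hν => sub_eq_zero.2 (h ν fun i _ => hν i)) μ

variable [DecidableEq I]

/-- The point obtained by replacing the coordinates in `T` by zero. -/
def zeroOn (T : Finset I) (μ : I → ℤ) : I → ℤ := fun i => if i ∈ T then 0 else μ i

-- The Bernoulli polynomial of degree `n + 1`, divided by `n + 1`, has difference `x ^ n`; the
-- division needs characteristic zero.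
variable (k) in
theorem exists_polynomial_antidifference (n : ℕ) :
    ∃ q : Polynomial k, ∀ x : k, q.eval (x + 1) - q.eval x = x ^ n := by
  have : Algebra ℚ k := DivisionRing.toRatAlgebra
  refine ⟨Polynomial.C ((n + 1 : k)⁻¹) *
    (Polynomial.bernoulli (n + 1)).map (algebraMap ℚ k), fun x => ?_⟩
  have h := congrArg (fun p => (p.map (algebraMap ℚ k)).eval x)
    (Polynomial.bernoulli_comp_one_add_X (n + 1))
  simp only [Polynomial.map_comp, Polynomial.eval_comp, Polynomial.map_add, Polynomial.map_one,
    Polynomial.map_X, Polynomial.eval_add, Polynomial.eval_one, Polynomial.eval_X,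
    nsmul_eq_mul, Polynomial.map_mul, Polynomial.map_natCast] at h
  rw [Polynomial.eval_mul, Polynomial.eval_mul, add_comm x 1, h]
  have : (n + 1 : k) ≠ 0 := Nat.cast_add_one_ne_zero n
  simp
  field_simp
  ring

/-- Summation in the variable `j`, monomial by monomial. Setting the variables in `T` to zero keeps
the result independent of them, so variables already treated are not disturbed. -/
theorem IsPoly.exists_antidifference [Fintype I] {G : (I → ℤ) → k} (hG : IsPoly G) (T : Finset I)
    (j : I) (hj : j ∉ T) : ∃ F : (I → ℤ) → k, IsPoly F ∧
      (∀ μ, F (μ + Pi.single j 1) - F μ = G (zeroOn T μ)) ∧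
      ∀ i ∈ T, ∀ μ, F (μ + Pi.single i 1) = F μ := by
  obtain ⟨Q, hQ⟩ := hG
  induction Q using MvPolynomial.induction_on' generalizing G with
  | monomial s c =>
    obtain ⟨q, hq⟩ := exists_polynomial_antidifference k (s j)
    refine ⟨fun μ => c * (∏ i ∈ Finset.univ.erase j, ((zeroOn T μ i : ℤ) : k) ^ s i) *
      q.eval (μ j : k), ?_, fun μ => ?_, fun i hi μ => ?_⟩
    · refine ((IsPoly.prod _ fun i => IsPoly.pow ?_ _).smul c).mul (IsPoly.polynomial_coord q j)
      by_cases hi : i ∈ T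
      · simpa [zeroOn, hi] using IsPoly.const (0 : k)
      · simpa [zeroOn, hi] using IsPoly.coord i
    · have e : ∏ i ∈ Finset.univ.erase j, ((zeroOn T (μ + Pi.single j 1) i : ℤ) : k) ^ s i =
          ∏ i ∈ Finset.univ.erase j, ((zeroOn T μ i : ℤ) : k) ^ s i :=
        Finset.prod_congr rfl fun i hi => by simp [zeroOn, Finset.ne_of_mem_erase hi]
      have e2 := hq (μ j)
      have e3 : ((zeroOn T μ j : ℤ) : k) = μ j := by simp [zeroOn, hj]
      rw [hQ, MvPolynomial.eval_monomial, Finsupp.prod_fintype _ _ (by simp),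
        ← Finset.mul_prod_erase _ _ (Finset.mem_univ j), e3, ← e2]
      beta_reduce
      rw [e]
      simp only [Pi.add_apply, Pi.single_eq_same, Int.cast_add, Int.cast_one]
      ring
    · have hij : i ≠ j := fun h => hj (h ▸ hi)
      have e : zeroOn T (μ + Pi.single i 1) = zeroOn T μ := by
        funext l
        by_cases hl : l = i
        · subst hl; simp [zeroOn, hi]
        · simp [zeroOn, hl]
      simp [e, hij.symm]
  | add p q hp hq =>
    obtain ⟨F, hF, hF1, hF2⟩ := hp (G := fun μ => MvPolynomial.eval (fun i => (μ i : k)) p)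
      fun μ => rfl
    obtain ⟨F', hF', hF1', hF2'⟩ := hq (G := fun μ => MvPolynomial.eval (fun i => (μ i : k)) q)
      fun μ => rfl
    refine ⟨_, hF.add hF', fun μ => ?_, fun i hi μ => ?_⟩
    · rw [hQ, map_add, ← hF1, ← hF1']; ring
    · simp only [hF2 i hi, hF2' i hi]

theorem apply_zeroOn_of_invariant {X : Type*} {P : I → Prop} {h : (I → ℤ) → X} (T : Finset I)
    (hT : ∀ i ∈ T, ∀ μ ∈ orthant P, h (μ + Pi.single i 1) = h μ) (μ : I → ℤ)
    (hμ : μ ∈ orthant P) : h (zeroOn T μ) = h μ := by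
  have step : ∀ i ∈ T, ∀ (n : ℕ), ∀ μ ∈ orthant P, h (μ + n • Pi.single i 1) = h μ := by
    intro i hi n
    induction n with
    | zero => intro μ _; simp
    | succ n ih =>
      intro μ hμ
      rw [succ_nsmul, ← add_assoc, hT i hi _ (add_mem hμ (nsmul_mem (single_mem_orthant i) n)),
        ih μ hμ]
  induction T using Finset.induction_on generalizing μ with
  | empty => rfl
  | insert j T hj ih =>
    have hu : Function.update μ j 0 ∈ orthant P := fun l hl => by
      by_cases h : l = j
      · subst h; simp
      · simpa [h] using hμ l hl
    have e : zeroOn (insert j T) μ = zeroOn T (Function.update μ j 0) := by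
      funext l
      by_cases h : l = j
      · subst h; simp [zeroOn]
      · simp [zeroOn, h]
    rw [e, ih (fun i hi => hT i (Finset.mem_insert_of_mem hi)) _ hu
      (fun i hi => step i (Finset.mem_insert_of_mem hi))]
    -- The walk between `μ j` and `0` must stay in the orthant: it starts at the point with the
    -- smaller `j`-th coordinate and goes up.
    rcases le_total 0 (μ j) with h0 | h0
    · rw [← step j (Finset.mem_insert_self j T) (μ j).toNat _ hu]
      congr 1
      funext l
      by_cases h : l = j
      · subst h; simp [h0]
      · simp [h]
    · rw [← step j (Finset.mem_insert_self j T) (-μ j).toNat μ hμ]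
      congr 1
      funext l
      by_cases h : l = j
      · subst h; simp [h0]
      · simp [h]

/-- A function on the orthant all of whose differences are polynomial is polynomial. -/
theorem exists_isPoly_extension [Fintype I] {P : I → Prop} {f : (I → ℤ) → k}
    (hf : ∀ i, ∃ G : (I → ℤ) → k, IsPoly G ∧
      ∀ μ ∈ orthant P, f (μ + Pi.single i 1) - f μ = G μ) :
    ∃ F : (I → ℤ) → k, IsPoly F ∧ ∀ μ ∈ orthant P, f μ = F μ := by
  have key : ∀ T : Finset I, ∃ F : (I → ℤ) → k, IsPoly F ∧ ∀ i ∈ T, ∀ μ ∈ orthant P,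
      f (μ + Pi.single i 1) - F (μ + Pi.single i 1) = f μ - F μ := by
    intro T
    induction T using Finset.induction_on with
    | empty => exact ⟨_, IsPoly.const 0, by simp⟩
    | insert j T hj ih =>
      obtain ⟨F, hF, hFT⟩ := ih
      obtain ⟨G, hG, hfG⟩ := hf j
      obtain ⟨F', hF', h1, h2⟩ :=
        (hG.sub ((hF.shift (Pi.single j 1)).sub hF)).exists_antidifference T j hj
      refine ⟨_, hF.add hF', fun i hi μ hμ => ?_⟩
      obtain rfl | hi := Finset.mem_insert.1 hi
      -- As `f - F` does not depend on the variables in `T`, its new difference may be computed at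
      -- `zeroOn T μ`, where it is the polynomial that `F'` sums.
      · have e1 := apply_zeroOn_of_invariant (h := fun μ => f μ - F μ) T hFT μ hμ
        have e2 := apply_zeroOn_of_invariant (h := fun μ => f μ - F μ) T hFT (μ + Pi.single i 1)
          (add_mem hμ (single_mem_orthant i))
        have e3 : zeroOn T (μ + Pi.single i 1) = zeroOn T μ + Pi.single i 1 := by
          funext l
          by_cases hl : l = i
          · subst hl; simp [zeroOn, hj]
          · simp [zeroOn, hl]
        have h0 : zeroOn T μ ∈ orthant P := fun l hl => by
          simp only [zeroOn]; split_ifs; exacts [le_rfl, hμ l hl]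
        have e4 := h1 μ
        have e5 := hfG _ h0
        rw [e3] at e2
        linear_combination e1 - e2 - e4 + e5
      · have e1 := h2 i hi μ
        have e2 := hFT i hi μ hμ
        linear_combination e2 - e1
  obtain ⟨F, hF, h⟩ := key Finset.univ
  refine ⟨_, hF.add (IsPoly.const (f 0 - F 0)), fun μ hμ => ?_⟩
  have e := apply_zeroOn_of_invariant (h := fun μ => f μ - F μ) Finset.univ h μ hμ
  have e0 : zeroOn Finset.univ μ = 0 := by funext i; simp [zeroOn]
  rw [e0] at e
  linear_combination -e

end Orthant

/-! ### Matrix coefficients of differential operators in a monomial basis. -/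

section OperatorMatrices

variable {k A : Type u} [Field k] [CommRing A] [Algebra k A] {I : Type} {P : I → Prop}
  (b : Module.Basis (orthant P) k A)

open Classical in
/-- The monomial with exponent `μ`, or zero if `μ` is outside the orthant. -/
def mon (μ : I → ℤ) : A := if h : μ ∈ orthant P then b ⟨μ, h⟩ else 0

open Classical in
/-- The coefficient of the monomial with exponent `ν`, or zero if `ν` is outside the orthant. -/
def monCoeff (ν : I → ℤ) : A →ₗ[k] k := if h : ν ∈ orthant P then b.coord ⟨ν, h⟩ else 0

theorem mon_coe (μ : orthant P) : mon b μ = b μ := by simp [mon]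

theorem monCoeff_of_notMem {μ : I → ℤ} (h : μ ∉ orthant P) : monCoeff b μ = 0 := by
  simp [monCoeff, h]

variable {b} in
theorem linearMap_ext_mon {B : Type*} [AddCommMonoid B] [Module k B] {f g : A →ₗ[k] B}
    (h : ∀ μ ∈ orthant P, f (mon b μ) = g (mon b μ)) : f = g :=
  b.ext fun μ => by simpa [mon_coe] using h μ μ.2

variable {b} in
theorem ext_monCoeff {x y : A} (h : ∀ μ ∈ orthant P, monCoeff b μ x = monCoeff b μ y) : x = y :=
  b.ext_elem fun μ => by simpa [monCoeff] using h μ μ.2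

open Classical in
theorem monCoeff_mon {μ : I → ℤ} (h : μ ∈ orthant P) (ν : I → ℤ) :
    monCoeff b ν (mon b μ) = if ν = μ then 1 else 0 := by
  by_cases hν : ν ∈ orthant P
  · simp [monCoeff, mon, h, hν, Finsupp.single_apply, eq_comm]
  · have : ν ≠ μ := fun e => hν (e ▸ h)
    simp [monCoeff_of_notMem b hν, this]

theorem monCoeff_mon_self {μ : I → ℤ} (h : μ ∈ orthant P) : monCoeff b μ (mon b μ) = 1 := by
  simp [monCoeff_mon b h]

theorem finite_monCoeff_ne_zero (x : A) : {ν | monCoeff b ν x ≠ 0}.Finite := by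
  refine (((b.repr x).support.finite_toSet.image Subtype.val)).subset fun ν hν => ?_
  by_cases h : ν ∈ orthant P
  · exact ⟨⟨ν, h⟩, by simpa [monCoeff, h] using hν, rfl⟩
  · exact absurd (by simp [monCoeff_of_notMem b h]) hν

theorem eq_sum_mon (x : A) (s : Finset (I → ℤ)) (hs : ∀ ν, monCoeff b ν x ≠ 0 → ν ∈ s) :
    x = ∑ ν ∈ s, monCoeff b ν x • mon b ν := by
  classical
  refine ext_monCoeff (b := b) fun μ hμ => ?_
  have hsum : ∀ ν ∈ s, monCoeff b μ (monCoeff b ν x • mon b ν) =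
      if μ = ν then monCoeff b ν x else 0 := fun ν _ => by
    by_cases h : ν ∈ orthant P
    · simp [monCoeff_mon b h]
    · simp [monCoeff_of_notMem b h]
  rw [map_sum, Finset.sum_congr rfl hsum, Finset.sum_ite_eq]
  split_ifs with h
  · rfl
  · exact not_not.1 fun h' => h (hs μ h')

/-- The algebra structure is that of a monoid algebra: monomials multiply by adding exponents. -/
def IsMonomialBasis : Prop := ∀ μ ν : orthant P, b (μ + ν) = b μ * b ν

variable {b} (hb : IsMonomialBasis b)
include hb

theorem IsMonomialBasis.mon_add {μ ν : I → ℤ} (hμ : μ ∈ orthant P) (hν : ν ∈ orthant P) :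
    mon b (μ + ν) = mon b μ * mon b ν := by
  have := hb ⟨μ, hμ⟩ ⟨ν, hν⟩
  simp only [← mon_coe] at this
  exact this

theorem IsMonomialBasis.monCoeff_add_mon_mul {κ : I → ℤ} (hκ : κ ∈ orthant P) (ν : I → ℤ) (x : A) :
    monCoeff b (ν + κ) (mon b κ * x) = monCoeff b ν x := by
  have : monCoeff b (ν + κ) ∘ₗ LinearMap.mulLeft k (mon b κ) = monCoeff b ν := by
    refine linearMap_ext_mon (b := b) fun μ hμ => ?_
    rw [LinearMap.comp_apply, LinearMap.mulLeft_apply, ← hb.mon_add hκ hμ, add_comm κ μ,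
      monCoeff_mon b (add_mem hμ hκ), monCoeff_mon b hμ]
    by_cases h : ν = μ
    · simp [h]
    · rw [if_neg h, if_neg fun h' => h (add_right_cancel h')]
  exact LinearMap.congr_fun this x

/-- Multiplication by `x^κ` only shifts exponents, so commuting with it takes the finite difference
of the coefficients in direction `κ` and raises the degree by `κ`. -/
theorem IsMonomialBasis.monCoeff_commutator {θ : Module.End k A} {κ μ : I → ℤ}
    (hκ : κ ∈ orthant P) (hμ : μ ∈ orthant P) (l : I → ℤ) :
    monCoeff b (μ + (l + κ)) ((θ * LinearMap.mulLeft k (mon b κ) -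
      LinearMap.mulLeft k (mon b κ) * θ) (mon b μ)) =
    monCoeff b (μ + κ + l) (θ (mon b (μ + κ))) - monCoeff b (μ + l) (θ (mon b μ)) := by
  have e : μ + (l + κ) = μ + κ + l := by abel
  have e' : μ + κ + l = μ + l + κ := by abel
  simp only [LinearMap.sub_apply, Module.End.mul_apply, LinearMap.mulLeft_apply, map_sub]
  rw [← hb.mon_add hκ hμ, add_comm κ μ, e]
  congr 1
  rw [e', hb.monCoeff_add_mon_mul hκ]

variable [Fintype I] [DecidableEq I]

/-- Induction on the order: the differences of the coefficients belong to commutators, which have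
smaller order. -/
theorem IsMonomialBasis.exists_isPoly [CharZero k] {p : ℕ} {θ : Module.End k A}
    (hθ : IsDiffOp k A p θ) (l : I → ℤ) :
    ∃ F : (I → ℤ) → k, IsPoly F ∧ ∀ μ ∈ orthant P, monCoeff b (μ + l) (θ (mon b μ)) = F μ := by
  induction p generalizing θ l with
  | zero =>
    refine exists_isPoly_extension fun i => ⟨_, IsPoly.const 0, fun μ hμ => ?_⟩
    rw [← hb.monCoeff_commutator (single_mem_orthant i) hμ, hθ]
    simp
  | succ p ih =>
    refine exists_isPoly_extension fun i => ?_
    obtain ⟨F, hF, h⟩ := ih (hθ (mon b (Pi.single i 1))) (l + Pi.single i 1)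
    refine ⟨F, hF, fun μ hμ => ?_⟩
    rw [← h μ hμ, hb.monCoeff_commutator (single_mem_orthant i) hμ]

theorem IsMonomialBasis.finite_support {p : ℕ} {θ : Module.End k A} (hθ : IsDiffOp k A p θ) :
    {l : I → ℤ | ∃ μ ∈ orthant P, monCoeff b (μ + l) (θ (mon b μ)) ≠ 0}.Finite := by
  have key : ∀ θ : Module.End k A, (∀ i, {l : I → ℤ | ∃ μ ∈ orthant P, monCoeff b (μ + l)
      ((θ * LinearMap.mulLeft k (mon b (Pi.single i 1)) -
      LinearMap.mulLeft k (mon b (Pi.single i 1)) * θ) (mon b μ)) ≠ 0}.Finite) →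
      {l : I → ℤ | ∃ μ ∈ orthant P, monCoeff b (μ + l) (θ (mon b μ)) ≠ 0}.Finite := by
    intro θ h
    -- For a degree occurring in no commutator (after its shift), the coefficient is constant in
    -- `μ`, hence equal to its value at `μ = 0`; that value is nonzero for finitely many degrees
    -- only.
    refine ((finite_monCoeff_ne_zero b (θ (mon b 0))).union (Set.finite_iUnion fun i =>
      (h i).preimage (add_left_injective (Pi.single i 1)).injOn)).subset ?_
    rintro l ⟨μ, hμ, hl⟩
    by_contra hcon
    simp only [Set.mem_union, Set.mem_iUnion, Set.mem_preimage, Set.mem_ofPred_eq, not_or,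
      not_exists, not_and, not_not] at hcon
    refine hl ?_
    have e0 : zeroOn Finset.univ μ = 0 := by funext i; simp [zeroOn]
    rw [← apply_zeroOn_of_invariant (P := P) (h := fun μ => monCoeff b (μ + l) (θ (mon b μ)))
      Finset.univ (fun i _ μ hμ => ?_) μ hμ]
    · simp only [e0, zero_add, hcon.1]
    · rw [← sub_eq_zero, ← hb.monCoeff_commutator (single_mem_orthant i) hμ]
      exact hcon.2 i μ hμ
  induction p generalizing θ with
  | zero => exact key θ fun i => by simp [hθ (mon b (Pi.single i 1))]
  | succ p ih => exact key θ fun i => ih (hθ _)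

end OperatorMatrices

/-! ### Extension of differential operators to all Laurent exponents. -/

section Symbols

variable {k A : Type u} [Field k] [CommRing A] [Algebra k A] {I : Type} {P : I → Prop}
  (b : Module.Basis (orthant P) k A)

open Classical in
/-- The polynomial giving the coefficients of the component of degree `l` of the differential
operator `θ`. -/
def symbol (θ : Module.End k A) (l : I → ℤ) : (I → ℤ) → k :=
  -- The default `0` is itself polynomial, so `entry_isPoly` holds for every endomorphism.
  if h : ∃ F : (I → ℤ) → k, IsPoly F ∧
    ∀ μ ∈ orthant P, monCoeff b (μ + l) (θ (mon b μ)) = F μ then h.choose else 0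

/-- The matrix coefficients of the extension of the differential operator `θ` to an operator on
the span of all Laurent monomials. -/
def entry (θ : Module.End k A) (ν μ : I → ℤ) : k := symbol b θ (ν - μ) μ

theorem entry_isPoly (θ : Module.End k A) (l : I → ℤ) : IsPoly fun μ => entry b θ (μ + l) μ := by
  simp only [entry, add_sub_cancel_left]
  change IsPoly (symbol b θ l)
  unfold symbol
  split_ifs with h
  · exact h.choose_spec.1
  · exact IsPoly.const 0

variable {b} [CharZero k] [Fintype I] [DecidableEq I] (hb : IsMonomialBasis b)
include hb

theorem IsMonomialBasis.entry_eq {θ : Module.End k A} (hθ : θ ∈ diffOps k A) {μ : I → ℤ}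
    (hμ : μ ∈ orthant P) (ν : I → ℤ) : entry b θ ν μ = monCoeff b ν (θ (mon b μ)) := by
  obtain ⟨p, hp⟩ := hθ
  have h := hb.exists_isPoly hp (ν - μ)
  rw [entry, symbol, dif_pos h, ← h.choose_spec.2 μ hμ, add_sub_cancel]

theorem IsMonomialBasis.entry_unique {θ : Module.End k A} (hθ : θ ∈ diffOps k A)
    {K : (I → ℤ) → (I → ℤ) → k} (hK : ∀ l, IsPoly fun μ => K (μ + l) μ)
    (h : ∀ μ ∈ orthant P, ∀ ν, K ν μ = monCoeff b ν (θ (mon b μ))) (ν μ : I → ℤ) :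
    entry b θ ν μ = K ν μ := by
  have := (entry_isPoly b θ (ν - μ)).eq_of_orthant (P := P) (hK (ν - μ))
    (fun τ hτ => by rw [hb.entry_eq hθ hτ, h τ hτ]) μ
  simpa using this

theorem IsMonomialBasis.exists_entry_support {θ : Module.End k A} (hθ : θ ∈ diffOps k A) :
    ∃ L : Finset (I → ℤ), ∀ ν μ, entry b θ ν μ ≠ 0 → ν - μ ∈ L := by
  obtain ⟨p, hp⟩ := id hθ
  refine ⟨(hb.finite_support hp).toFinset, fun ν μ h => ?_⟩
  rw [Set.Finite.mem_toFinset]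
  by_contra hcon
  simp only [Set.mem_ofPred_eq, not_exists, not_and, not_not] at hcon
  have := (entry_isPoly b θ (ν - μ)).eq_of_orthant (P := P) (IsPoly.const 0)
    (fun τ hτ => by rw [hb.entry_eq hθ hτ, hcon τ hτ]) μ
  exact h (by simpa using this)

/-- In each degree the right side is polynomial in `μ`, so by uniqueness of the extension it
suffices to multiply matrices on the orthant. This makes the Laurent span a module. -/
theorem IsMonomialBasis.entry_mul {θ φ : Module.End k A} (hθ : θ ∈ diffOps k A)
    (hφ : φ ∈ diffOps k A) (L : Finset (I → ℤ)) (hL : ∀ ν μ, entry b φ ν μ ≠ 0 → ν - μ ∈ L)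
    (ν μ : I → ℤ) :
    entry b (θ * φ) ν μ = ∑ l ∈ L, entry b θ ν (μ + l) * entry b φ (μ + l) μ := by
  refine hb.entry_unique (mul_mem hθ hφ)
    (K := fun ν μ => ∑ l ∈ L, entry b θ ν (μ + l) * entry b φ (μ + l) μ)
    (fun l' => IsPoly.sum _ fun l => ?_) (fun μ hμ ν => ?_) ν μ
  · refine IsPoly.mul ?_ (entry_isPoly b φ l)
    have := (entry_isPoly b θ (l' - l)).shift l
    simpa [add_assoc] using this
  · have e := eq_sum_mon b (φ (mon b μ)) (L.map (addLeftEmbedding μ)) fun ν hν => by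
      rw [← hb.entry_eq hφ hμ] at hν
      exact Finset.mem_map.2 ⟨ν - μ, hL _ _ hν, by simp⟩
    rw [Module.End.mul_apply, e, map_sum, map_sum, Finset.sum_map]
    refine Finset.sum_congr rfl fun l _ => ?_
    simp only [addLeftEmbedding_apply, map_smul, smul_eq_mul, ← hb.entry_eq hφ hμ]
    by_cases hl : μ + l ∈ orthant P
    · rw [hb.entry_eq hθ hl, mul_comm]
    -- An intermediate exponent outside the orthant contributes nothing, whatever value the
    -- extension of `θ` has there.
    · rw [hb.entry_eq hφ hμ, monCoeff_of_notMem b hl]; simp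

theorem IsMonomialBasis.entry_add {θ φ : Module.End k A} (hθ : θ ∈ diffOps k A)
    (hφ : φ ∈ diffOps k A) (ν μ : I → ℤ) :
    entry b (θ + φ) ν μ = entry b θ ν μ + entry b φ ν μ :=
  hb.entry_unique (add_mem hθ hφ) (K := fun ν μ => entry b θ ν μ + entry b φ ν μ)
    (fun l => (entry_isPoly b θ l).add (entry_isPoly b φ l))
    (fun μ hμ ν => by rw [hb.entry_eq hθ hμ, hb.entry_eq hφ hμ]; simp) ν μ

theorem IsMonomialBasis.entry_algebraMap (c : k) (ν μ : I → ℤ) :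
    entry b (algebraMap k (Module.End k A) c) ν μ = if ν = μ then c else 0 :=
  hb.entry_unique (Subalgebra.algebraMap_mem _ c) (K := fun ν μ => if ν = μ then c else 0)
    (fun l => by simpa using IsPoly.const _)
    (fun μ hμ ν => by simp [Algebra.algebraMap_eq_smul_one, monCoeff_mon b hμ]) ν μ

theorem IsMonomialBasis.entry_eq_zero_of_neg {θ : Module.End k A} (hθ : θ ∈ diffOps k A) {i : I}
    (hi : P i) {ν μ : I → ℤ} (hμ : 0 ≤ μ i) (hν : ν i < 0) : entry b θ ν μ = 0 := by
  -- Freeze the `i`-th coordinate at `μ i`. On the orthant the target exponent has negative `i`-th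
  -- coordinate, so the polynomial in the remaining variables is zero.
  have := ((entry_isPoly b θ (ν - μ)).comp_update i (μ i)).eq_of_orthant (P := P)
    (IsPoly.const 0) (fun τ hτ => ?_) μ
  · simpa using this
  · rw [hb.entry_eq hθ (fun j hj => ?_), monCoeff_of_notMem b fun h => ?_]
    · simp
    · have := h i hi
      simp at this
      omega
    · by_cases h : j = i
      · subst h; simpa using hμ
      · simpa [h] using hτ j hj

/-- The matrix of a homogeneous operator is given by its values on monomials. -/
theorem IsMonomialBasis.entry_of_apply_mon {θ : Module.End k A} (hθ : θ ∈ diffOps k A) {l : I → ℤ}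
    {g : (I → ℤ) → k} (hg : IsPoly g) (h : ∀ μ ∈ orthant P, θ (mon b μ) = g μ • mon b (μ + l))
    (hz : ∀ μ ∈ orthant P, μ + l ∉ orthant P → g μ = 0) (ν μ : I → ℤ) :
    entry b θ ν μ = if ν = μ + l then g μ else 0 :=
  hb.entry_unique hθ (K := fun ν μ => if ν = μ + l then g μ else 0)
    (fun l' => by
      by_cases hl : l' = l
      · simpa [hl] using hg
      · simpa [hl] using IsPoly.const 0)
    (fun μ hμ ν => by
      rw [h μ hμ, map_smul]
      by_cases hl : μ + l ∈ orthant P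
      · simp [monCoeff_mon b hl]
      · simp [hz μ hμ hl]) ν μ

end Symbols

/-! ### Supply of homogeneous differential operators. -/

section BasicOperators

variable {k A : Type u} [Field k] [CommRing A] [Algebra k A] {I : Type} {P : I → Prop}

theorem mulLeft_mem_diffOps (x : A) : LinearMap.mulLeft k x ∈ diffOps k A :=
  ⟨0, fun y => by ext z; simp [mul_left_comm]⟩

theorem mem_diffOps_of_leibniz (D : Module.End k A) (h : ∀ x y, D (x * y) = x * D y + y * D x) :
    D ∈ diffOps k A := by
  refine ⟨1, fun x => ?_⟩
  have e : D * LinearMap.mulLeft k x - LinearMap.mulLeft k x * D = LinearMap.mulLeft k (D x) := by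
    ext y
    simp only [LinearMap.sub_apply, Module.End.mul_apply, LinearMap.mulLeft_apply, h]
    ring
  rw [e]
  intro y
  ext z
  simp [mul_left_comm]

variable (b : Module.Basis (orthant P) k A)

/-- The derivation multiplying the monomial of exponent `μ` by `μ i` and translating its exponent
by `l`. -/
def eulerShift (i : I) (l : I → ℤ) : Module.End k A :=
  b.constr k fun μ => ((μ : I → ℤ) i : k) • mon b (μ + l)

theorem eulerShift_mon (i : I) (l : I → ℤ) {μ : I → ℤ} (hμ : μ ∈ orthant P) :
    eulerShift b i l (mon b μ) = (μ i : k) • mon b (μ + l) := by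
  have : mon b μ = b ⟨μ, hμ⟩ := by simp [mon, hμ]
  rw [this, eulerShift, b.constr_basis]

variable {b} (hb : IsMonomialBasis b)
include hb

/-- This is `x^l x_i ∂_i`, a derivation once `hl` ensures that only terms with coefficient zero are
cut off by the orthant. The cases used are the Euler operator (`l = 0`) and `∂_i`. -/
theorem IsMonomialBasis.eulerShift_mem (i : I) (l : I → ℤ)
    (hl : ∀ μ ∈ orthant P, μ + l ∉ orthant P → μ i = 0) : eulerShift b i l ∈ diffOps k A := by
  refine mem_diffOps_of_leibniz _ fun x y => ?_
  have key : ∀ μ ∈ orthant P, ∀ ν ∈ orthant P,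
      (μ i : k) • mon b (μ + ν + l) = (μ i : k) • (mon b ν * mon b (μ + l)) := by
    intro μ hμ ν hν
    by_cases h : μ + l ∈ orthant P
    · rw [← hb.mon_add hν h]
      congr 2
      abel
    · simp [hl μ hμ h]
  have : (LinearMap.mul k A).compr₂ (eulerShift b i l) =
      (LinearMap.mul k A).compl₂ (eulerShift b i l) +
      ((LinearMap.mul k A).compl₂ (eulerShift b i l)).flip := by
    refine linearMap_ext_mon (b := b) fun μ hμ => linearMap_ext_mon (b := b) fun ν hν => ?_
    simp only [LinearMap.compr₂_apply, LinearMap.mul_apply', LinearMap.add_apply,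
      LinearMap.compl₂_apply, LinearMap.flip_apply, eulerShift_mon b i l hμ,
      eulerShift_mon b i l hν, ← hb.mon_add hμ hν, eulerShift_mon b i l (add_mem hμ hν),
      mul_smul_comm]
    rw [← key μ hμ ν hν, ← key ν hν μ hμ, add_comm ν μ, ← add_smul]
    simp [add_comm]
  exact LinearMap.congr_fun₂ this x y

variable [CharZero k] [Fintype I] [DecidableEq I]

theorem IsMonomialBasis.entry_eulerShift (i : I) (l : I → ℤ)
    (hl : ∀ μ ∈ orthant P, μ + l ∉ orthant P → μ i = 0) (ν μ : I → ℤ) :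
    entry b (eulerShift b i l) ν μ = if ν = μ + l then (μ i : k) else 0 :=
  hb.entry_of_apply_mon (hb.eulerShift_mem i l hl) (IsPoly.coord i)
    (fun _ hμ => eulerShift_mon b i l hμ) (fun μ hμ h => by simp [hl μ hμ h]) ν μ

theorem IsMonomialBasis.entry_mulLeft {κ : I → ℤ} (hκ : κ ∈ orthant P) (ν μ : I → ℤ) :
    entry b (LinearMap.mulLeft k (mon b κ)) ν μ = if ν = μ + κ then (1 : k) else 0 :=
  hb.entry_of_apply_mon (mulLeft_mem_diffOps _) (IsPoly.const 1)
    (fun μ hμ => by rw [LinearMap.mulLeft_apply, ← hb.mon_add hκ hμ, add_comm, one_smul])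
    (fun μ hμ h => absurd (add_mem hμ hκ) h) ν μ

/-- Composition of operators which are homogeneous. -/
theorem IsMonomialBasis.entry_mul_homogeneous {θ φ : Module.End k A} (hθ : θ ∈ diffOps k A)
    (hφ : φ ∈ diffOps k A) {l l' : I → ℤ} {g g' : (I → ℤ) → k}
    (h : ∀ ν μ, entry b θ ν μ = if ν = μ + l then g μ else 0)
    (h' : ∀ ν μ, entry b φ ν μ = if ν = μ + l' then g' μ else 0) (ν μ : I → ℤ) :
    entry b (θ * φ) ν μ = if ν = μ + (l' + l) then g (μ + l') * g' μ else 0 := by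
  rw [hb.entry_mul hθ hφ {l'} (fun ν μ hne => ?_)]
  · simp [h, h', add_assoc]
  · rw [h'] at hne
    have := (ite_ne_right_iff.1 hne).1
    simp [this]

/-- For every degree `l` there is a homogeneous operator of degree `l` whose coefficients are
nonzero whenever they can be. -/
theorem IsMonomialBasis.exists_translation (l : I → ℤ) : ∃ θ ∈ diffOps k A, ∃ g : (I → ℤ) → k,
    (∀ ν μ, entry b θ ν μ = if ν = μ + l then g μ else 0) ∧
    ∀ μ, (∀ i, P i → (0 ≤ μ i ↔ 0 ≤ (μ + l) i)) → g μ ≠ 0 := by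
  generalize hn : ∑ i, (l i).natAbs = n
  induction n generalizing l with
  | zero =>
    have hl : l = 0 := by
      funext i
      have := (Finset.sum_eq_zero_iff.1 hn) i (Finset.mem_univ i)
      simpa using this
    subst hl
    refine ⟨1, one_mem _, fun _ => 1, fun ν μ => ?_, fun _ _ => one_ne_zero⟩
    have := hb.entry_algebraMap (1 : k) ν μ
    simpa using this
  | succ n ih =>
    obtain ⟨i, hi⟩ : ∃ i, l i ≠ 0 := by
      by_contra! h
      simp [h] at hn
    have hsum : ∀ c : ℤ, (l i + c).natAbs + 1 = (l i).natAbs →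
        ∑ j, ((l + Pi.single i c : I → ℤ) j).natAbs = n := by
      intro c hc
      rw [← Finset.add_sum_erase _ _ (Finset.mem_univ i)] at hn ⊢
      have : ∑ j ∈ Finset.univ.erase i, ((l + Pi.single i c : I → ℤ) j).natAbs =
          ∑ j ∈ Finset.univ.erase i, (l j).natAbs :=
        Finset.sum_congr rfl fun j hj => by simp [Finset.ne_of_mem_erase hj]
      rw [this]
      simp only [Pi.add_apply, Pi.single_eq_same]
      omega
    -- Moving `l` one unit towards zero keeps the target between `μ` and `μ + l`, so the signs still
    -- agree and induction applies.
    have hpat : ∀ (c : ℤ) (μ : I → ℤ), (0 < l i ∧ c = -1 ∨ l i < 0 ∧ c = 1) →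
        (∀ j, P j → (0 ≤ μ j ↔ 0 ≤ (μ + l) j)) →
        ∀ j, P j → (0 ≤ μ j ↔ 0 ≤ (μ + (l + Pi.single i c) : I → ℤ) j) := by
      intro c μ hc h j hj
      have := h j hj
      by_cases hji : j = i
      · subst hji
        simp only [Pi.add_apply, Pi.single_eq_same] at this ⊢
        omega
      · simpa [hji] using this
    rcases lt_or_gt_of_ne hi with hneg | hpos
    · obtain ⟨θ, hθ, g, h1, h2⟩ := ih (l + Pi.single i 1) (hsum 1 (by omega))
      -- One step down is `∂_i` at a polynomial coordinate and multiplication by `x_i⁻¹` at an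
      -- invertible one. The factor from `∂_i` could vanish only when the step crosses from `0` to
      -- `-1`, which the sign condition forbids.
      by_cases hP : P i
      · have hl : ∀ μ ∈ orthant P, μ + Pi.single i (-1) ∉ orthant P → μ i = 0 := by
          intro μ hμ h
          by_contra h0
          refine h fun j hj => ?_
          have := hμ j hj
          by_cases hji : j = i
          · subst hji
            simp only [Pi.add_apply, Pi.single_eq_same]
            omega
          · simpa [hji] using this
        refine ⟨_, mul_mem (hb.eulerShift_mem i _ hl) hθ,
          fun μ => ((μ + (l + Pi.single i 1) : I → ℤ) i : k) * g μ, fun ν μ => ?_, fun μ hμ => ?_⟩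
        · rw [hb.entry_mul_homogeneous (hb.eulerShift_mem i _ hl) hθ
            (hb.entry_eulerShift i _ hl) h1]
          rw [add_assoc l, ← Pi.single_add]
          simp only [add_neg_cancel, Pi.single_zero, add_zero]
        · refine mul_ne_zero ?_ (h2 μ (hpat 1 μ (Or.inr ⟨hneg, rfl⟩) hμ))
          have := hμ i hP
          simp only [Pi.add_apply, Pi.single_eq_same] at this ⊢
          rw [Int.cast_ne_zero]
          omega
      · have hκ : Pi.single i (-1) ∈ orthant P := fun j hj => by
          have : j ≠ i := fun h => hP (h ▸ hj)
          simp [this]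
        refine ⟨_, mul_mem (mulLeft_mem_diffOps (mon b (Pi.single i (-1)))) hθ,
          fun μ => 1 * g μ, fun ν μ => ?_, fun μ hμ => ?_⟩
        · rw [hb.entry_mul_homogeneous (mulLeft_mem_diffOps _) hθ (hb.entry_mulLeft hκ) h1]
          rw [add_assoc l, ← Pi.single_add]
          simp only [add_neg_cancel, Pi.single_zero, add_zero]
        · exact mul_ne_zero one_ne_zero (h2 μ (hpat 1 μ (Or.inr ⟨hneg, rfl⟩) hμ))
    · obtain ⟨θ, hθ, g, h1, h2⟩ := ih (l + Pi.single i (-1)) (hsum (-1) (by omega))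
      refine ⟨_, mul_mem (mulLeft_mem_diffOps (mon b (Pi.single i 1))) hθ,
        fun μ => 1 * g μ, fun ν μ => ?_, fun μ hμ => ?_⟩
      · rw [hb.entry_mul_homogeneous (mulLeft_mem_diffOps _) hθ
          (hb.entry_mulLeft (single_mem_orthant i)) h1]
        rw [add_assoc l, ← Pi.single_add]
        simp only [neg_add_cancel, Pi.single_zero, add_zero]
      · exact mul_ne_zero one_ne_zero (h2 μ (hpat (-1) μ (Or.inl ⟨hpos, rfl⟩) hμ))

/-- Products of factors `x_i ∂_i - σ i`, one for each `σ ∈ S`, with `i` a coordinate separating `σ`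
from `μ`. -/
theorem IsMonomialBasis.exists_interpolation (S : Finset (I → ℤ)) (μ : I → ℤ) (hμ : μ ∉ S) :
    ∃ θ ∈ diffOps k A, ∃ g : (I → ℤ) → k,
    (∀ ν τ, entry b θ ν τ = if ν = τ then g τ else 0) ∧ g μ ≠ 0 ∧ ∀ τ ∈ S, g τ = 0 := by
  induction S using Finset.induction_on with
  | empty =>
    refine ⟨1, one_mem _, fun _ => 1, fun ν τ => ?_, one_ne_zero, by simp⟩
    have := hb.entry_algebraMap (1 : k) ν τ
    simpa using this
  | insert σ S _ ih =>
    obtain ⟨hμσ, hμS⟩ := not_or.1 (fun h => hμ (Finset.mem_insert.2 h))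
    obtain ⟨θ, hθ, g, h1, h2, h3⟩ := ih hμS
    obtain ⟨i, hi⟩ := Function.ne_iff.1 hμσ
    have hl : ∀ μ ∈ orthant P, μ + 0 ∉ orthant P → μ i = 0 := fun μ hμ h => by
      simp [hμ] at h
    have hE := hb.eulerShift_mem i 0 hl
    have hc : algebraMap k (Module.End k A) (-σ i) ∈ diffOps k A := Subalgebra.algebraMap_mem _ _
    refine ⟨_, mul_mem (add_mem hE hc) hθ, fun τ => (τ i - σ i) * g τ, fun ν τ => ?_, ?_, ?_⟩
    · rw [hb.entry_mul_homogeneous (l := 0) (l' := 0) (g := fun τ => τ i - σ i) (g' := g)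
        (add_mem hE hc) hθ (fun ν τ => ?_) (by simpa using h1)]
      · simp
      · rw [hb.entry_add hE hc, hb.entry_eulerShift i 0 hl, hb.entry_algebraMap]
        simp only [add_zero]
        split_ifs <;> simp [sub_eq_add_neg]
    · refine mul_ne_zero ?_ h2
      rw [sub_ne_zero]
      exact_mod_cast hi
    · intro τ hτ
      obtain rfl | hτ := Finset.mem_insert.1 hτ
      · simp
      · simp [h3 τ hτ]

end BasicOperators

/-! ### Invariant operators and the lattice of their degrees. -/

section Invariants

variable {k A : Type u} [Field k] [CommRing A] [Algebra k A] {I : Type} {P : I → Prop}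
  (b : Module.Basis (orthant P) k A)

/-- The invariants under `Γ` are the operators all of whose homogeneous components have degree
in `Λ`. -/
def IsDegreeLattice (Γ : Set (A ≃ₐ[k] A)) (Λ : AddSubgroup (I → ℤ)) : Prop :=
  ∀ θ ∈ diffOps k A, θ ∈ invariantDiffOps Γ ↔ ∀ ν μ, entry b θ ν μ ≠ 0 → ν - μ ∈ Λ

variable {b} [CharZero k] [Fintype I] [DecidableEq I] (hb : IsMonomialBasis b)
include hb

/-- Conjugation by `tr t` scales the `(ν, μ)` entry by a factor depending only on the degree `ν -
μ`, so commuting with `tr t` forces that factor to be `1` in every degree that occurs. -/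
theorem IsMonomialBasis.isDegreeLattice {T : Type*} (S : Set T) (tr : T → (A ≃ₐ[k] A))
    (χ : T → (I → ℤ) → kˣ) (hadd : ∀ t μ ν, χ t (μ + ν) = χ t μ * χ t ν)
    (htr : ∀ t, ∀ μ ∈ orthant P, tr t (mon b μ) = (χ t μ : k) • mon b μ)
    (Λ : AddSubgroup (I → ℤ)) (hΛ : ∀ l, l ∈ Λ ↔ ∀ t ∈ S, χ t l = 1) :
    IsDegreeLattice b (tr '' S) Λ := by
  intro θ hθ
  have hcoeff : ∀ t ν x, monCoeff b ν (tr t x) = (χ t ν : k) * monCoeff b ν x := by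
    intro t ν x
    have : monCoeff b ν ∘ₗ (tr t).toLinearMap = (χ t ν : k) • monCoeff b ν := by
      refine linearMap_ext_mon (b := b) fun μ hμ => ?_
      simp only [LinearMap.comp_apply, AlgEquiv.toLinearMap_apply, htr t μ hμ, map_smul,
        LinearMap.smul_apply, monCoeff_mon b hμ]
      split_ifs with h
      · rw [h]
      · simp
    exact LinearMap.congr_fun this x
  have hcomm : ∀ t, (tr t).toLinearMap * θ = θ * (tr t).toLinearMap ↔
      ∀ μ ∈ orthant P, ∀ ν, (χ t ν : k) * entry b θ ν μ = χ t μ * entry b θ ν μ := by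
    intro t
    refine ⟨fun h μ hμ ν => ?_, fun h => ?_⟩
    · have := congrArg (monCoeff b ν) (LinearMap.congr_fun h (mon b μ))
      simpa [hcoeff, htr t μ hμ, hb.entry_eq hθ hμ] using this
    · refine linearMap_ext_mon (b := b) fun μ hμ => ext_monCoeff (b := b) fun ν _ => ?_
      simpa [hcoeff, htr t μ hμ, hb.entry_eq hθ hμ] using h μ hμ ν
  have hmem : θ ∈ invariantDiffOps (tr '' S) ↔
      ∀ t ∈ S, (tr t).toLinearMap * θ = θ * (tr t).toLinearMap := by
    rw [invariantDiffOps, Algebra.mem_inf, Subalgebra.mem_centralizer_iff]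
    simp [hθ]
  rw [hmem]
  constructor
  · intro h ν μ hne
    rw [hΛ]
    intro t ht
    by_contra hχ
    have hz : ∀ τ ∈ orthant P, entry b θ (τ + (ν - μ)) τ = 0 := by
      intro τ hτ
      have := (hcomm t).1 (h t ht) τ hτ (τ + (ν - μ))
      by_contra h0
      have := mul_right_cancel₀ h0 this
      rw [hadd, Units.val_inj, mul_eq_left] at this
      exact hχ this
    have := (entry_isPoly b θ (ν - μ)).eq_of_orthant (P := P) (IsPoly.const 0) hz μ
    exact hne (by simpa using this)
  · intro h t ht
    rw [hcomm]
    intro μ _ ν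
    by_cases h0 : entry b θ ν μ = 0
    · simp [h0]
    · have h1 := (hΛ _).1 (h ν μ h0) t ht
      have h2 := hadd t μ (ν - μ)
      rw [add_sub_cancel, h1, mul_one] at h2
      rw [h2]

end Invariants

/-! ### Simple modules from finite cells. -/

section FiniteDimensionalRepresentations

variable {k A : Type u} [Field k] [CommRing A] [Algebra k A] {I : Type} {P : I → Prop}
  {b : Module.Basis (orthant P) k A} [CharZero k] [Fintype I] [DecidableEq I]
  (hb : IsMonomialBasis b) {Γ : Set (A ≃ₐ[k] A)} {Λ : AddSubgroup (I → ℤ)}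
  (hΛ : IsDegreeLattice b Γ Λ)

include hb in
theorem IsMonomialBasis.entry_mul_eq_sum {θ φ : Module.End k A} (hθ : θ ∈ diffOps k A)
    (hφ : φ ∈ diffOps k A) (ν μ : I → ℤ) (F : Finset (I → ℤ))
    (hF : ∀ τ, entry b θ ν τ ≠ 0 → entry b φ τ μ ≠ 0 → τ ∈ F) :
    entry b (θ * φ) ν μ = ∑ τ ∈ F, entry b θ ν τ * entry b φ τ μ := by
  obtain ⟨L, hL⟩ := hb.exists_entry_support hφ
  have h1 := hb.entry_mul hθ hφ L hL ν μ
  have h2 : ∑ l ∈ L, entry b θ ν (μ + l) * entry b φ (μ + l) μ =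
      ∑ τ ∈ L.map (addLeftEmbedding μ), entry b θ ν τ * entry b φ τ μ := by
    rw [Finset.sum_map]; rfl
  rw [h1, h2, ← finsum_eq_sum_of_support_subset _ (fun τ hτ => ?_),
    ← finsum_eq_sum_of_support_subset _ (fun τ hτ => ?_)]
  · exact hF τ (left_ne_zero_of_mul hτ) (right_ne_zero_of_mul hτ)
  · exact Finset.mem_coe.2 (Finset.mem_map.2
      ⟨τ - μ, hL _ _ (right_ne_zero_of_mul hτ), by simp⟩)

/-- A set of exponents spanning a subquotient of the module of Laurent monomials over the ring of
invariant operators, all of whose exponents are equivalent. -/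
structure IsCell (P : I → Prop) (Λ : AddSubgroup (I → ℤ)) (S : Set (I → ℤ)) : Prop where
  sub_mem : ∀ μ ∈ S, ∀ ν ∈ S, ν - μ ∈ Λ
  sign : ∀ μ ∈ S, ∀ ν ∈ S, ∀ i, P i → (0 ≤ μ i ↔ 0 ≤ ν i)
  mem : ∀ μ ∈ S, ∀ ν, ν - μ ∈ Λ → (∀ i, P i → (0 ≤ μ i ↔ 0 ≤ ν i)) → ν ∈ S

variable {S : Set (I → ℤ)} [Fintype S] (hS : IsCell P Λ S)

include hb hΛ hS

/-- The representation of the invariant operators on the subquotient given by a cell. -/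
def cellMatrix : invariantDiffOps Γ →ₐ[k] Matrix S S k where
  toFun θ := Matrix.of fun ν μ => entry b θ.1 ν μ
  map_one' := by
    ext ν μ
    have := hb.entry_algebraMap (1 : k) ν.1 μ.1
    rw [map_one] at this
    simp [this, Matrix.one_apply, Subtype.ext_iff]
  map_zero' := by
    ext ν μ
    have := hb.entry_algebraMap (0 : k) ν.1 μ.1
    rw [map_zero] at this
    simp [this]
  map_add' θ φ := by
    ext ν μ
    simp [hb.entry_add θ.2.1 φ.2.1]
  commutes' c := by
    ext ν μ
    have := hb.entry_algebraMap c ν.1 μ.1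
    simp [this, Matrix.algebraMap_matrix_apply, Subtype.ext_iff]
  map_mul' θ φ := by
    ext ν μ
    have e := hb.entry_mul_eq_sum θ.2.1 φ.2.1 ν μ S.toFinset
      fun τ h1 h2 => by
        have h1' := (hΛ _ θ.2.1).1 θ.2 _ _ h1
        have h2' := (hΛ _ φ.2.1).1 φ.2 _ _ h2
        -- On a path `μ → τ → ν` a nonnegative coordinate stays nonnegative; as `μ` and `ν` have the
        -- same signs, so does `τ`. Thus intermediate exponents remain in the cell.
        refine Set.mem_toFinset.2 (hS.mem _ μ.2 τ h2' fun i hi => ?_)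
        refine ⟨fun h => not_lt.1 fun h' => h2 (hb.entry_eq_zero_of_neg φ.2.1 hi h h'), fun h => ?_⟩
        refine (hS.sign _ μ.2 _ ν.2 i hi).2 (not_lt.1 fun h' => ?_)
        exact h1 (hb.entry_eq_zero_of_neg θ.2.1 hi h h')
    rw [← Finset.sum_set_coe] at e
    simpa [Matrix.mul_apply] using e

/-- The invariant operators act on a cell by all matrices. -/
theorem IsMonomialBasis.exists_cellMatrix_eq_single (ν μ : S) :
    ∃ θ, cellMatrix hb hΛ hS θ = Matrix.single ν μ 1 := by
  obtain ⟨θ, hθ, g, h1, h2⟩ := hb.exists_translation (ν.1 - μ.1)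
  -- A matrix unit: the diagonal `φ` isolates `μ` within the cell, then `θ` translates it to `ν`.
  obtain ⟨φ, hφ, f, h3, h4, h5⟩ := hb.exists_interpolation
    (S.toFinset.erase μ.1) μ.1 (by simp)
  have h3' : ∀ ν τ, entry b φ ν τ = if ν = τ + 0 then f τ else 0 := by simpa using h3
  have hmul := hb.entry_mul_homogeneous hθ hφ h1 h3'
  have hg : g μ ≠ 0 := h2 _ fun i hi => by
    rw [add_sub_cancel]
    exact hS.sign _ μ.2 _ ν.2 i hi
  have hinv : θ * φ ∈ invariantDiffOps Γ := by
    refine (hΛ _ (mul_mem hθ hφ)).2 fun ν' μ' h => ?_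
    rw [hmul] at h
    have := (ite_ne_right_iff.1 h).1
    rw [this]
    simpa using hS.sub_mem _ μ.2 _ ν.2
  refine ⟨(g μ * f μ)⁻¹ • ⟨θ * φ, hinv⟩, ?_⟩
  rw [map_smul]
  ext ν' μ'
  change (g μ * f μ)⁻¹ * entry b (θ * φ) ν' μ' = _
  rw [hmul, Matrix.single_apply]
  by_cases hμ : μ = μ'
  · subst hμ
    by_cases hν : ν = ν'
    · subst hν
      simp
      field_simp
    · have : ¬ ν'.1 = ν.1 := fun h => hν (Subtype.ext h.symm)
      simp [hν, this]
  · have : f μ' = 0 := h5 _ (Finset.mem_erase.2 ⟨fun h => hμ (Subtype.ext h.symm), by simp⟩)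
    simp [this, hμ]

/-- The module of a cell is simple, so that an invariant operator killing all simple finite
dimensional modules acts on it as zero. -/
theorem IsMonomialBasis.entry_eq_zero_of_mem_annihilator (x : invariantDiffOps Γ) [Nonempty S]
    (hx : ∀ (M : Type u) [AddCommGroup M] [Module k M] [Module (invariantDiffOps Γ) M]
      [IsScalarTower k (invariantDiffOps Γ) M], IsSimpleModule (invariantDiffOps Γ) M →
      FiniteDimensional k M → x ∈ Module.annihilator (invariantDiffOps Γ) M) (ν μ : S) :
    entry b x.1 ν μ = 0 := by
  let ρ : invariantDiffOps Γ →ₐ[k] Module.End k (S → k) :=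
    (Matrix.toLinAlgEquiv'.toAlgHom).comp (cellMatrix hb hΛ hS)
  let : Module (invariantDiffOps Γ) (S → k) := Module.compHom (S → k) ρ.toRingHom
  have hsmul : ∀ (θ : invariantDiffOps Γ) (v : S → k),
      θ • v = (cellMatrix hb hΛ hS θ).mulVec v := fun θ v => rfl
  have : IsScalarTower k (invariantDiffOps Γ) (S → k) := ⟨fun c θ v => by
    rw [hsmul, hsmul, map_smul, Matrix.smul_mulVec]⟩
  have hsimple : IsSimpleModule (invariantDiffOps Γ) (S → k) := by
    refine isSimpleModule_iff_toSpanSingleton_surjective.2 ⟨inferInstance, fun v hv w => ?_⟩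
    obtain ⟨τ, hτ⟩ := Function.ne_iff.1 hv
    choose u hu using fun ν => hb.exists_cellMatrix_eq_single hΛ hS ν τ
    refine ⟨∑ ν, (w ν * (v τ)⁻¹) • u ν, ?_⟩
    rw [LinearMap.toSpanSingleton_apply, hsmul, map_sum]
    funext σ
    have hτ' : v τ ≠ 0 := hτ
    simp [hu, Matrix.sum_mulVec, Matrix.single_mulVec, Function.update_apply,
      hτ']
  have := (Module.mem_annihilator.1 (hx (S → k) hsimple inferInstance)) (Pi.single μ 1)
  rw [hsmul] at this
  have := congrFun this ν
  simpa [cellMatrix] using this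

end FiniteDimensionalRepresentations

/-! ### Finiteness of cells and enough simple modules. -/

section EnoughModules

/-- The sum of the `φ i * ν i` is constant on the coset, and the sign pattern makes every term
nonnegative. This bounds the coordinates in `P`, and these determine `ν` by `hinj`. -/
theorem finite_cell {I : Type} [Fintype I] {P : I → Prop} {Λ : AddSubgroup (I → ℤ)} (φ : I → ℤ)
    (hφ : ∀ i, P i → φ i ≠ 0) (hφ' : ∀ i, ¬ P i → φ i = 0)
    (hφΛ : ∀ l ∈ Λ, ∑ i, φ i * l i = 0) (hinj : ∀ l ∈ Λ, (∀ i, P i → l i = 0) → l = 0)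
    (μ : I → ℤ) :
    {ν : I → ℤ | ν - μ ∈ Λ ∧ ∀ i, P i → (0 ≤ ν i ↔ 0 < φ i)}.Finite := by
  classical
  set c := ∑ i, φ i * μ i with hc
  have hbox : (Set.Icc (fun _ : I => -c) (fun _ : I => c)).Finite := Set.finite_Icc _ _
  refine Set.Finite.of_finite_image (f := fun ν i => if P i then ν i else 0)
    ((hbox.union (Set.finite_singleton 0)).subset ?_) ?_
  · rintro _ ⟨ν, ⟨hν, hs⟩, rfl⟩
    left
    have hsum : ∑ i, φ i * ν i = c := by
      have := hφΛ _ hν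
      simp only [Pi.sub_apply, mul_sub, Finset.sum_sub_distrib] at this
      rw [hc]
      linarith
    have hnn : ∀ i, 0 ≤ φ i * ν i := by
      intro i
      by_cases hi : P i
      · have h1 := hs i hi
        have h2 := hφ i hi
        rcases lt_or_gt_of_ne h2 with h | h
        · exact mul_nonneg_of_nonpos_of_nonpos h.le (by omega)
        · exact mul_nonneg h.le (by omega)
      · simp [hφ' i hi]
    have hle : ∀ i, φ i * ν i ≤ c := fun i =>
      hsum ▸ Finset.single_le_sum (f := fun i => φ i * ν i) (fun j _ => hnn j) (Finset.mem_univ i)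
    have habs : ∀ i, P i → |ν i| ≤ c := by
      intro i hi
      refine le_trans ?_ (hle i)
      rw [← abs_of_nonneg (hnn i), abs_mul]
      exact le_mul_of_one_le_left (abs_nonneg _) (Int.one_le_abs (hφ i hi))
    have hc0 : 0 ≤ c := hsum ▸ Finset.sum_nonneg fun i _ => hnn i
    refine ⟨fun i => ?_, fun i => ?_⟩ <;> dsimp only <;> split_ifs with hi
    · exact (abs_le.1 (habs i hi)).1
    · omega
    · exact (abs_le.1 (habs i hi)).2
    · omega
  · intro ν hν ν' hν' h
    refine sub_eq_zero.1 (hinj _ ?_ fun i hi => ?_)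
    · have := sub_mem hν.1 hν'.1
      simpa using this
    · have := congrFun h i
      simp only [hi, if_true] at this
      simp [this]

variable {k A : Type u} [Field k] [CommRing A] [Algebra k A] {I : Type} {P : I → Prop}
  {b : Module.Basis (orthant P) k A} [CharZero k] [Fintype I] [DecidableEq I]
  (hb : IsMonomialBasis b) {Γ : Set (A ≃ₐ[k] A)} {Λ : AddSubgroup (I → ℤ)}
  (hΛ : IsDegreeLattice b Γ Λ)
include hb hΛ

theorem IsMonomialBasis.hasEnoughSimpleFD (φ : I → ℤ) (hφ : ∀ i, P i → φ i ≠ 0)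
    (hφ' : ∀ i, ¬ P i → φ i = 0) (hφΛ : ∀ l ∈ Λ, ∑ i, φ i * l i = 0)
    (hinj : ∀ l ∈ Λ, (∀ i, P i → l i = 0) → l = 0) :
    HasEnoughSimpleFD k (invariantDiffOps Γ) := by
  intro x hx
  have hzero : ∀ l μ, entry b x.1 (μ + l) μ = 0 := by
    intro l
    by_cases hl : l ∈ Λ
    -- It suffices to treat those `μ` for which both `μ` and `μ + l` have the signs of `φ`: this is
    -- an infinite range for each coordinate, and both exponents then lie in one finite cell.
    · refine (entry_isPoly b x.1 l).eq_zero_of_pi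
        (fun i => {n | P i → ((0 ≤ n ↔ 0 < φ i) ∧ (0 ≤ n + l i ↔ 0 < φ i))}) (fun i => ?_)
        fun μ hμ => ?_
      · by_cases hi : P i
        · rcases lt_or_gt_of_ne (hφ i hi) with h | h
          · refine (Set.Iio_infinite (min 0 (-l i))).mono fun n hn _ => ?_
            rw [Set.mem_Iio] at hn
            omega
          · refine (Set.Ici_infinite (max 0 (-l i))).mono fun n hn _ => ?_
            rw [Set.mem_Ici] at hn
            omega
        · exact Set.infinite_univ.mono fun n _ h => absurd h hi
      · let S : Set (I → ℤ) := {ν | ν - μ ∈ Λ ∧ ∀ i, P i → (0 ≤ ν i ↔ 0 < φ i)}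
        have : Fintype S := (finite_cell φ hφ hφ' hφΛ hinj μ).fintype
        have hS : IsCell P Λ S := by
          refine ⟨fun α hα β hβ => ?_, fun α hα β hβ i hi => ?_, fun α hα β h h' => ⟨?_, ?_⟩⟩
          · simpa using sub_mem hβ.1 hα.1
          · rw [hα.2 i hi, hβ.2 i hi]
          · simpa using add_mem h hα.1
          · intro i hi
            rw [← h' i hi, hα.2 i hi]
        have h1 : μ ∈ S := ⟨by simp, fun i hi => (hμ i hi).1⟩
        have h2 : μ + l ∈ S := ⟨by simpa using hl, fun i hi => (hμ i hi).2⟩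
        have : Nonempty S := ⟨⟨μ, h1⟩⟩
        exact hb.entry_eq_zero_of_mem_annihilator hΛ hS x hx ⟨_, h2⟩ ⟨_, h1⟩
    · intro μ
      by_contra h
      exact hl (by simpa using (hΛ _ x.2.1).1 x.2 _ _ h)
  refine Subtype.ext (linearMap_ext_mon (b := b) fun μ hμ => ext_monCoeff (b := b) fun ν _ => ?_)
  rw [← hb.entry_eq x.2.1 hμ]
  have := hzero (ν - μ) μ
  rw [add_sub_cancel] at this
  rw [this]
  simp

end EnoughModules

/-! ### Ladder operators and the absence of finite dimensional modules. -/

section NoFiniteDimensionalModules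

/-- A ladder operator pair `x`, `y` for an operator `t` whose products are polynomials in `t` such
that every weight can be raised indefinitely or lowered indefinitely excludes nonzero finite
dimensional modules. -/
theorem not_hasNonzeroFD_of_ladder {k R : Type u} [Field k] [IsAlgClosed k] [CharZero k] [Ring R]
    [Algebra k R] (t x y : R) (N : k) (hN : N ≠ 0) (p q : Polynomial k)
    (hx : t * x = x * (t + algebraMap k R N)) (hy : t * y = y * (t - algebraMap k R N))
    (hyx : y * x = Polynomial.aeval t p) (hxy : x * y = Polynomial.aeval t q)
    (hpq : ∀ c : k, (∀ n : ℕ, p.eval (c + n * N) ≠ 0) ∨ ∀ n : ℕ, q.eval (c - n * N) ≠ 0) :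
    ¬ HasNonzeroFD k R := by
  rintro ⟨M, _, _, _, _, _, _⟩
  let T : Module.End k M := Algebra.lsmul k k M t
  have hT : ∀ v, T v = t • v := fun v => rfl
  obtain ⟨c, hc⟩ := Module.End.exists_eigenvalue T
  have hfin := Module.End.finite_hasEigenvalue T
  have haeval : ∀ (f : Polynomial k) (d : k) (v : M), t • v = d • v →
      Polynomial.aeval t f • v = f.eval d • v := by
    intro f d v hv
    have hpow : ∀ n : ℕ, t ^ n • v = d ^ n • v := by
      intro n
      induction n with
      | zero => simp
      | succ n ih => rw [pow_succ', mul_smul, ih, smul_comm, hv, smul_smul, pow_succ]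
    rw [Polynomial.aeval_eq_sum_range, Polynomial.eval_eq_sum_range, Finset.sum_smul,
      Finset.sum_smul]
    exact Finset.sum_congr rfl fun n _ => by rw [smul_assoc, hpow, smul_smul]
  -- `z` shifts eigenvalues of `t` by `e`, and `w * z` acts by a nonzero scalar at each stage, so no
  -- vector dies. The infinitely many eigenvalues contradict finite dimension.
  have infinite : ∀ (z w : R) (f : Polynomial k) (e : k), e ≠ 0 →
      t * z = z * (t + algebraMap k R e) → w * z = Polynomial.aeval t f →
      (∀ n : ℕ, f.eval (c + n * e) ≠ 0) → False := by
    intro z w f e he hz hwz hf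
    have step : ∀ n : ℕ, ∃ v : M, v ≠ 0 ∧ t • v = (c + n * e) • v := by
      intro n
      induction n with
      | zero =>
        obtain ⟨v, hv⟩ := hc.exists_hasEigenvector
        exact ⟨v, hv.2, by simpa [hT] using hv.apply_eq_smul⟩
      | succ n ih =>
        obtain ⟨v, hv, htv⟩ := ih
        refine ⟨z • v, fun h0 => ?_, ?_⟩
        · have h1 := haeval f _ v htv
          rw [← hwz, mul_smul, h0, smul_zero] at h1
          exact (smul_ne_zero (hf n) hv) h1.symm
        · rw [← mul_smul, hz, mul_smul, add_smul, algebraMap_smul, htv, ← add_smul, smul_comm]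
          congr 1
          push_cast
          ring
    refine Set.infinite_range_of_injective (f := fun n : ℕ => c + n * e) (fun a b h => ?_)
      (hfin.subset ?_)
    · have := mul_right_cancel₀ he (add_left_cancel h)
      exact_mod_cast this
    · rintro _ ⟨n, rfl⟩
      obtain ⟨v, hv, h⟩ := step n
      exact Module.End.hasEigenvalue_of_hasEigenvector
        ⟨Module.End.mem_eigenspace_iff.2 h, hv⟩
  rcases hpq c with h | h
  · exact infinite x y p N hN hx hyx h
  · refine infinite y x q (-N) (neg_ne_zero.2 hN) ?_ hxy fun n => ?_
    · rw [hy, map_neg, sub_eq_add_neg]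
    · simpa [sub_eq_add_neg] using h n

/-- The roots are `0, …, N - 1`. A zero on the way up would make `c` a negative integer, a zero on
the way down a nonnegative one. -/
theorem descPochhammer_eval_ne_zero_or {k : Type u} [Field k] [CharZero k] (N : ℕ) (c : k) :
    (∀ n : ℕ, (descPochhammer k N).eval (c + n * N + N) ≠ 0) ∨
      ∀ n : ℕ, (descPochhammer k N).eval (c - n * N) ≠ 0 := by
  by_contra! h
  obtain ⟨⟨n, hn⟩, n', hn'⟩ := h
  rw [descPochhammer_eval_eq_prod_range, Finset.prod_eq_zero_iff] at hn hn'
  obtain ⟨j, hj, h1⟩ := hn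
  obtain ⟨j', -, h2⟩ := hn'
  have e : ((j' + n' * N + n * N + N : ℕ) : k) = (j : ℕ) := by
    push_cast
    linear_combination h1 - h2
  have e' : j' + n' * N + n * N + N = j := by exact_mod_cast e
  have := Finset.mem_range.1 hj
  omega

variable {k A : Type u} [Field k] [IsAlgClosed k] [CharZero k] [CommRing A] [Algebra k A] {I : Type}
  {P : I → Prop} {b : Module.Basis (orthant P) k A} [Fintype I] [DecidableEq I]
  (hb : IsMonomialBasis b) {Γ : Set (A ≃ₐ[k] A)} {Λ : AddSubgroup (I → ℤ)}
  (hΛ : IsDegreeLattice b Γ Λ)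
include hb

omit [IsAlgClosed k] in
theorem IsMonomialBasis.ext_entry {θ φ : Module.End k A} (hθ : θ ∈ diffOps k A)
    (hφ : φ ∈ diffOps k A) (h : ∀ ν μ, entry b θ ν μ = entry b φ ν μ) : θ = φ :=
  linearMap_ext_mon (b := b) fun μ hμ => ext_monCoeff (b := b) fun ν _ => by
    rw [← hb.entry_eq hθ hμ, ← hb.entry_eq hφ hμ, h]

omit [IsAlgClosed k] in
theorem IsMonomialBasis.entry_aeval_euler (i : I) (h0 : eulerShift b i 0 ∈ diffOps k A)
    (p : Polynomial k) (ν μ : I → ℤ) :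
    entry b (Polynomial.aeval (eulerShift b i 0) p) ν μ =
      if ν = μ + 0 then p.eval (μ i : k) else 0 := by
  refine hb.entry_of_apply_mon (Algebra.adjoin_le (Set.singleton_subset_iff.2 h0)
    (Polynomial.aeval_mem_adjoin_singleton k _)) (IsPoly.polynomial_coord p i) (fun μ hμ => ?_)
    (fun μ hμ h => absurd (by simpa using hμ) h) ν μ
  rw [add_zero]
  refine Module.End.aeval_apply_of_hasEigenvector ⟨Module.End.mem_eigenspace_iff.2 ?_, fun h => ?_⟩
  · rw [eulerShift_mon b i 0 hμ, add_zero]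
  · have := monCoeff_mon_self b hμ
    rw [h, map_zero] at this
    exact zero_ne_one this

include hΛ

/-- Take `x = x^l`, `y = x^(N e_i - l) ∂_i^N` and `t = x_i ∂_i`, of degrees `l`, `-l` and `0`, with
`N = l i`. Since no other polynomial coordinate occurs in `l`, both monomials are regular, and `x *
y`, `y * x` are falling factorials in `t` and `t + N`. -/
theorem IsMonomialBasis.not_hasNonzeroFD (l : I → ℤ) (hl : l ∈ Λ) (i : I) (hi : P i)
    (hpos : 0 < l i) (hzero : ∀ j, P j → j ≠ i → l j = 0) :
    ¬ HasNonzeroFD k (invariantDiffOps Γ) := by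
  obtain ⟨N, hN⟩ : ∃ N : ℕ, l i = N := ⟨(l i).toNat, by omega⟩
  have hlM : l ∈ orthant P := fun j hj => by
    by_cases h : j = i
    · subst h; exact hpos.le
    · rw [hzero j hj h]
  have hl' : Pi.single i (N : ℤ) - l ∈ orthant P := fun j hj => by
    by_cases h : j = i
    · subst h; simp [hN]
    · simp [h, hzero j hj h]
  have hd : ∀ μ ∈ orthant P, μ + Pi.single i (-1) ∉ orthant P → μ i = 0 := by
    intro μ hμ h
    by_contra h0
    refine h fun j hj => ?_
    have := hμ j hj
    by_cases hji : j = i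
    · subst hji
      simp only [Pi.add_apply, Pi.single_eq_same]
      omega
    · simpa [hji] using this
  have h0 : ∀ μ ∈ orthant P, μ + 0 ∉ orthant P → μ i = 0 := fun μ hμ h => by simp [hμ] at h
  have hE := hb.eulerShift_mem i 0 h0
  have hD := hb.eulerShift_mem i _ hd
  have entE := hb.entry_eulerShift i 0 h0
  have entD : ∀ (n : ℕ) (ν μ : I → ℤ), entry b (eulerShift b i (Pi.single i (-1)) ^ n) ν μ =
      if ν = μ + Pi.single i (-(n : ℤ)) then (descPochhammer k n).eval (μ i : k) else 0 := by
    intro n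
    induction n with
    | zero =>
      intro ν μ
      have := hb.entry_algebraMap (1 : k) ν μ
      simpa using this
    | succ n ih =>
      intro ν μ
      rw [pow_succ', hb.entry_mul_homogeneous hD (pow_mem hD n) (hb.entry_eulerShift i _ hd) ih]
      rw [← Pi.single_add]
      push_cast
      rw [neg_add, descPochhammer_succ_right]
      simp [sub_eq_add_neg, mul_comm]
  set x := LinearMap.mulLeft k (mon b l)
  set y := LinearMap.mulLeft k (mon b (Pi.single i (N : ℤ) - l)) *
    eulerShift b i (Pi.single i (-1)) ^ N
  have hx : x ∈ diffOps k A := mulLeft_mem_diffOps _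
  have hy : y ∈ diffOps k A := mul_mem (mulLeft_mem_diffOps _) (pow_mem hD N)
  have entx : ∀ ν μ, entry b x ν μ = if ν = μ + l then 1 else 0 := hb.entry_mulLeft hlM
  have enty : ∀ ν μ, entry b y ν μ =
      if ν = μ + -l then (descPochhammer k N).eval (μ i : k) else 0 := by
    intro ν μ
    rw [hb.entry_mul_homogeneous (mulLeft_mem_diffOps _) (pow_mem hD N) (hb.entry_mulLeft hl')
      (entD N), one_mul, Pi.single_neg, ← add_sub_assoc, neg_add_cancel, zero_sub]
  have hEN : ∀ (c : k), eulerShift b i 0 + algebraMap k _ c ∈ diffOps k A :=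
    fun c => add_mem hE (Subalgebra.algebraMap_mem _ c)
  have entEN : ∀ (c : k) (ν μ : I → ℤ), entry b (eulerShift b i 0 + algebraMap k _ c) ν μ =
      if ν = μ + 0 then (μ i : k) + c else 0 := by
    intro c ν μ
    rw [hb.entry_add hE (Subalgebra.algebraMap_mem _ c), entE, hb.entry_algebraMap, add_zero]
    split_ifs <;> simp
  have rel1 : eulerShift b i 0 * x = x * (eulerShift b i 0 + algebraMap k _ (N : k)) :=
    hb.ext_entry (mul_mem hE hx) (mul_mem hx (hEN _)) fun ν μ => by
      rw [hb.entry_mul_homogeneous hE hx entE entx, hb.entry_mul_homogeneous hx (hEN _) entx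
        (entEN _)]
      simp [hN]
  have rel2 : eulerShift b i 0 * y = y * (eulerShift b i 0 + algebraMap k _ (-(N : k))) :=
    hb.ext_entry (mul_mem hE hy) (mul_mem hy (hEN _)) fun ν μ => by
      rw [hb.entry_mul_homogeneous hE hy entE enty, hb.entry_mul_homogeneous hy (hEN _) enty
        (entEN _)]
      simp [hN, mul_comm]
  have haev : ∀ p : Polynomial k, Polynomial.aeval (eulerShift b i 0) p ∈ diffOps k A :=
    fun p => Algebra.adjoin_le (Set.singleton_subset_iff.2 hE)
      (Polynomial.aeval_mem_adjoin_singleton k _)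
  have rel3 : y * x = Polynomial.aeval (eulerShift b i 0)
      ((descPochhammer k N).comp (Polynomial.X + Polynomial.C (N : k))) :=
    hb.ext_entry (mul_mem hy hx) (haev _) fun ν μ => by
      rw [hb.entry_mul_homogeneous hy hx enty entx, hb.entry_aeval_euler i hE]
      simp [hN]
  have rel4 : x * y = Polynomial.aeval (eulerShift b i 0) (descPochhammer k N) :=
    hb.ext_entry (mul_mem hx hy) (haev _) fun ν μ => by
      rw [hb.entry_mul_homogeneous hx hy entx enty, hb.entry_aeval_euler i hE]
      simp
  have invE : eulerShift b i 0 ∈ invariantDiffOps Γ := (hΛ _ hE).2 fun ν μ h => by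
    rw [entE] at h
    simp [(ite_ne_right_iff.1 h).1]
  have invx : x ∈ invariantDiffOps Γ := (hΛ _ hx).2 fun ν μ h => by
    rw [entx] at h
    simp [(ite_ne_right_iff.1 h).1, hl]
  have invy : y ∈ invariantDiffOps Γ := (hΛ _ hy).2 fun ν μ h => by
    rw [enty] at h
    simp [(ite_ne_right_iff.1 h).1, hl]
  have hval : ∀ p : Polynomial k,
      ((Polynomial.aeval (⟨eulerShift b i 0, invE⟩ : invariantDiffOps Γ) p :
        invariantDiffOps Γ) : Module.End k A) = Polynomial.aeval (eulerShift b i 0) p :=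
    fun p => Polynomial.aeval_subalgebra_coe p _ _
  have hN0 : (N : k) ≠ 0 := by
    rw [Nat.cast_ne_zero]
    omega
  refine not_hasNonzeroFD_of_ladder (⟨_, invE⟩ : invariantDiffOps Γ) ⟨x, invx⟩ ⟨y, invy⟩ (N : k)
    hN0 _ _ (Subtype.ext rel1) (Subtype.ext ?_) (Subtype.ext (rel3.trans (hval _).symm))
    (Subtype.ext (rel4.trans (hval _).symm)) fun c => ?_
  · rw [map_neg] at rel2
    rw [sub_eq_add_neg]
    exact rel2
  · simpa using descPochhammer_eval_ne_zero_or N c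

end NoFiniteDimensionalModules

/-! ### Laurent characters of a torus. -/

section Characters

variable {k : Type u} [Field k] {ι : Type} [Fintype ι]

variable (k) in
/-- The character of the torus `(kˣ)^ι` with exponents `e`. -/
def charOf (e : ι → ℤ) : (ι → kˣ) →* kˣ where
  toFun g := ∏ i, g i ^ e i
  map_one' := by simp
  map_mul' g h := by simp [mul_zpow, Finset.prod_mul_distrib]

theorem charOf_apply (e : ι → ℤ) (g : ι → kˣ) : charOf k e g = ∏ i, g i ^ e i := rfl

theorem charOf_add (e f : ι → ℤ) (g : ι → kˣ) :
    charOf k (e + f) g = charOf k e g * charOf k f g := by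
  simp [charOf_apply, zpow_add, Finset.prod_mul_distrib]

theorem charOf_zero (g : ι → kˣ) : charOf k (0 : ι → ℤ) g = 1 := by simp [charOf_apply]

theorem charOf_neg (e : ι → ℤ) (g : ι → kˣ) : charOf k (-e) g = (charOf k e g)⁻¹ := by
  simp [charOf_apply]

theorem charOf_single [DecidableEq ι] (i : ι) (n : ℤ) (g : ι → kˣ) :
    charOf k (Pi.single i n) g = g i ^ n := by
  rw [charOf_apply, Finset.prod_eq_single i]
  · simp
  · intro j _ hj; simp [hj]
  · simp

theorem charOf_nsmul (n : ℕ) (e : ι → ℤ) (g : ι → kˣ) : charOf k (n • e) g = charOf k e g ^ n := by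
  induction n with
  | zero => simp [charOf_zero]
  | succ n ih => rw [succ_nsmul, charOf_add, ih, pow_succ]

theorem charOf_zsmul (n : ℤ) (e : ι → ℤ) (g : ι → kˣ) : charOf k (n • e) g = charOf k e g ^ n := by
  simp only [charOf_apply, ← Finset.prod_zpow, Pi.smul_apply, smul_eq_mul, mul_comm n, zpow_mul]

theorem charOf_sum {κ : Type*} (s : Finset κ) (c : κ → ℤ) (E : κ → ι → ℤ) (g : ι → kˣ) :
    charOf k (∑ j ∈ s, c j • E j) g = ∏ j ∈ s, charOf k (E j) g ^ c j := by
  classical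
  induction s using Finset.induction_on with
  | empty => simp [charOf_zero]
  | insert j s hj ih =>
    rw [Finset.sum_insert hj, Finset.prod_insert hj, charOf_add, charOf_zsmul, ih]

theorem exists_pow_ne_one [Infinite k] {n : ℕ} (hn : n ≠ 0) : ∃ t : kˣ, t ^ n ≠ 1 := by
  by_contra! h
  -- The factor `X` takes care of the point `0`, which is not a unit.
  have : (Polynomial.X * (Polynomial.X ^ n - Polynomial.C 1) : Polynomial k) = 0 := by
    refine Polynomial.funext fun x => ?_
    by_cases hx : x = 0
    · simp [hx]
    · have := congrArg Units.val (h (Units.mk0 x hx))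
      simp only [Units.val_pow_eq_pow_val, Units.val_mk0, Units.val_one] at this
      simp [this]
  exact mul_ne_zero Polynomial.X_ne_zero (Polynomial.X_pow_sub_C_ne_zero (Nat.pos_of_ne_zero hn) 1)
    this

theorem exists_zpow_ne_one [Infinite k] {n : ℤ} (hn : n ≠ 0) : ∃ t : kˣ, t ^ n ≠ 1 := by
  obtain ⟨t, ht⟩ := exists_pow_ne_one (k := k) (Int.natAbs_ne_zero.2 hn)
  refine ⟨t, fun h => ht ?_⟩
  rcases Int.natAbs_eq n with e | e
  · rw [e] at h; exact_mod_cast h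
  · rw [e, zpow_neg, inv_eq_one] at h; exact_mod_cast h

instance infinite_units [Infinite k] : Infinite kˣ := by
  by_contra h
  have : Finite kˣ := not_infinite_iff_finite.1 h
  obtain ⟨t, ht⟩ := exists_pow_ne_one (k := k) (Nat.card_pos (α := kˣ)).ne'
  exact ht pow_card_eq_one'

theorem charOf_injective [Infinite k] : Function.Injective (charOf k : (ι → ℤ) → _) := by
  classical
  intro e f h
  by_contra hne
  obtain ⟨i, hi⟩ := Function.ne_iff.1 hne
  obtain ⟨t, ht⟩ := exists_zpow_ne_one (k := k) (sub_ne_zero.2 hi)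
  have := DFunLike.congr_fun h (Pi.mulSingle i t)
  simp only [charOf_apply] at this
  rw [Finset.prod_eq_single i (fun j _ hj => by simp [hj]) (by simp),
    Finset.prod_eq_single i (fun j _ hj => by simp [hj]) (by simp)] at this
  simp only [Pi.mulSingle_eq_same] at this
  exact ht (by rw [zpow_sub, this, mul_inv_cancel])

variable (k ι) in
theorem linearIndependent_charOf [Infinite k] :
    LinearIndependent k fun (e : ι → ℤ) (g : ι → kˣ) => (charOf k e g : k) :=
  (linearIndependent_monoidHom (ι → kˣ) k).comp
    (fun e : ι → ℤ => (Units.coeHom k).comp (charOf k e))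
    fun e f h => charOf_injective (k := k) <| by
      ext g : 1
      exact Units.ext (DFunLike.congr_fun h g)

end Characters

/-! ### Bases of regular functions consisting of monomials. -/

section MonomialBases

variable {k : Type u} [Field k] {X : Type u} {J : Type} {c : J → X → k}
  {M : Type} [AddMonoid M] {F : M → X → k}

theorem regular_le_span (h0 : F 0 = 1) (hadd : ∀ μ ν, F (μ + ν) = F μ * F ν)
    (hc : ∀ j, c j ∈ Set.range F) :
    Subalgebra.toSubmodule (regular c) ≤ Submodule.span k (Set.range F) := by
  let F' : Multiplicative M →* (X → k) :=
    { toFun := fun μ => F μ.toAdd, map_one' := h0, map_mul' := fun μ ν => hadd _ _ }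
  rw [regular, Algebra.adjoin_eq_span]
  refine Submodule.span_mono ?_
  have : Submonoid.closure (Set.range c) ≤ MonoidHom.mrange F' := by
    rw [Submonoid.closure_le]
    rintro _ ⟨j, rfl⟩
    obtain ⟨μ, h⟩ := hc j
    exact ⟨Multiplicative.ofAdd μ, h⟩
  intro f hf
  obtain ⟨μ, h⟩ := this hf
  exact ⟨μ.toAdd, h⟩

/-- The basis of the regular functions given by a family of monomials. -/
def monomialBasis (h0 : F 0 = 1) (hadd : ∀ μ ν, F (μ + ν) = F μ * F ν)
    (hc : ∀ j, c j ∈ Set.range F) (hF : ∀ μ, F μ ∈ regular c) (hli : LinearIndependent k F) :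
    Module.Basis M k (RegularFunctions c) :=
  Module.Basis.mk (v := fun μ => (⟨F μ, hF μ⟩ : regular c))
    (LinearIndependent.of_comp (regular c).val.toLinearMap hli) (by
      rintro x -
      have h := regular_le_span h0 hadd hc x.2
      have e : Set.range F = (regular c).val.toLinearMap ''
          Set.range fun μ => (⟨F μ, hF μ⟩ : regular c) := by
        rw [← Set.range_comp]; rfl
      rw [e, ← Submodule.map_span] at h
      obtain ⟨y, hy, hyx⟩ := h
      have : y = x := Subtype.ext hyx
      exact this ▸ hy)

theorem monomialBasis_val (h0 : F 0 = 1) (hadd : ∀ μ ν, F (μ + ν) = F μ * F ν)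
    (hc : ∀ j, c j ∈ Set.range F) (hF : ∀ μ, F μ ∈ regular c) (hli : LinearIndependent k F)
    (μ : M) : (monomialBasis h0 hadd hc hF hli μ).1 = F μ := by
  have : monomialBasis h0 hadd hc hF hli μ = (⟨F μ, hF μ⟩ : regular c) :=
    Module.Basis.mk_apply _ _ μ
  rw [this]

end MonomialBases

/-! ### Regular characters, one parameter subgroups and connectedness. -/

section TorusCharacters

variable {k : Type u} [Field k] {m : ℕ}

theorem charOf_mem_regular (e : Fin m → ℤ) :
    (fun g => (charOf k e g : k)) ∈ regular (torusCoord k m) := by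
  have h : (fun g : Torus k m => (charOf k e g : k)) =
      ∏ i, fun g : Torus k m => ((g i ^ e i : kˣ) : k) := by
    funext g
    simp [charOf_apply, Finset.prod_apply]
  rw [h]
  refine Subalgebra.prod_mem _ fun i _ => ?_
  obtain ⟨n, hn⟩ := Int.eq_nat_or_neg (e i)
  rcases hn with hn | hn
  · have : (fun g : Torus k m => ((g i ^ e i : kˣ) : k)) = torusCoord k m (Sum.inl i) ^ n := by
      funext g; simp [hn, torusCoord]
    rw [this]
    exact (regular (torusCoord k m)).pow_mem (Algebra.subset_adjoin ⟨Sum.inl i, rfl⟩) n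
  · have : (fun g : Torus k m => ((g i ^ e i : kˣ) : k)) = torusCoord k m (Sum.inr i) ^ n := by
      funext g; simp [hn, torusCoord]
    rw [this]
    exact (regular (torusCoord k m)).pow_mem (Algebra.subset_adjoin ⟨Sum.inr i, rfl⟩) n

/-- A character which is a regular function is a Laurent monomial. -/
theorem exists_eq_charOf [Infinite k] (η : Torus k m →* kˣ)
    (hη : (fun g => (η g : k)) ∈ regular (torusCoord k m)) : ∃ e : Fin m → ℤ, η = charOf k e := by
  have hspan : (fun g => (η g : k)) ∈
      Submodule.span k (Set.range fun (e : Fin m → ℤ) (g : Torus k m) => (charOf k e g : k)) := by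
    refine regular_le_span (c := torusCoord k m) ?_ ?_ ?_ hη
    · funext g; simp [charOf_zero]
    · intro e f; funext g; simp [charOf_add]
    · rintro (i | i)
      · exact ⟨Pi.single i 1, by funext g; simp [charOf_single, torusCoord]⟩
      · exact ⟨Pi.single i (-1), by funext g; simp [charOf_single, torusCoord]⟩
  by_contra! hne
  -- Independence of characters: `η` lies in the span of the Laurent monomials, hence must be one of
  -- them.
  have hli := linearIndependent_monoidHom (Torus k m) k
  refine hli.notMem_span_image (s := Set.range fun e => (Units.coeHom k).comp (charOf k e))
    (x := (Units.coeHom k).comp η) ?_ ?_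
  · rintro ⟨e, he⟩
    refine hne e ?_
    exact MonoidHom.ext fun g => (Units.ext (DFunLike.congr_fun he g)).symm
  · rw [← Set.range_comp]
    exact hspan

/-- The one parameter subgroup of the torus with exponents `ν`. -/
def cochar (ν : Fin m → ℤ) (t : kˣ) : Torus k m := fun i => t ^ ν i

theorem charOf_cochar (e ν : Fin m → ℤ) (t : kˣ) :
    charOf k e (cochar ν t) = t ^ ∑ i, ν i * e i := by
  simp only [charOf_apply, cochar, ← zpow_mul]
  induction (Finset.univ : Finset (Fin m)) using Finset.induction_on with
  | empty => simp
  | insert i s hi ih => rw [Finset.prod_insert hi, Finset.sum_insert hi, ih, zpow_add]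

theorem exists_polynomial_of_regular (ν : Fin m → ℤ) {f : Torus k m → k}
    (hf : f ∈ regular (torusCoord k m)) :
    ∃ (n : ℕ) (p : Polynomial k), ∀ t : kˣ, (t : k) ^ n * f (cochar ν t) = p.eval (t : k) := by
  induction hf using Algebra.adjoin_induction with
  | mem f hf =>
    have key : ∀ a : ℤ, ∃ (n : ℕ) (p : Polynomial k), ∀ t : kˣ,
        (t : k) ^ n * ((t ^ a : kˣ) : k) = p.eval (t : k) := by
      intro a
      obtain ⟨n, rfl | rfl⟩ := Int.eq_nat_or_neg a
      · exact ⟨0, Polynomial.X ^ n, fun t => by simp⟩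
      · exact ⟨n, 1, fun t => by simp⟩
    obtain ⟨i | i, rfl⟩ := hf
    · simpa [torusCoord, cochar] using key (ν i)
    · simpa [torusCoord, cochar] using key (-ν i)
  | algebraMap c => exact ⟨0, Polynomial.C c, fun t => by simp⟩
  | add f g _ _ hf hg =>
    obtain ⟨n, p, hp⟩ := hf
    obtain ⟨n', q, hq⟩ := hg
    refine ⟨n + n', Polynomial.X ^ n' * p + Polynomial.X ^ n * q, fun t => ?_⟩
    simp only [Pi.add_apply, Polynomial.eval_add, Polynomial.eval_mul, Polynomial.eval_pow,
      Polynomial.eval_X, ← hp, ← hq]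
    ring
  | mul f g _ _ hf hg =>
    obtain ⟨n, p, hp⟩ := hf
    obtain ⟨n', q, hq⟩ := hg
    refine ⟨n + n', p * q, fun t => ?_⟩
    simp only [Pi.mul_apply, Polynomial.eval_mul, ← hp, ← hq]
    ring

/-- A regular function pulls back to a Laurent polynomial in `t`, which is zero or has finitely many
zeros. So the map is continuous from the cofinite topology, and an infinite cofinite space is
connected. -/
theorem isPreconnected_range_cochar [Infinite k] (ν : Fin m → ℤ) :
    @IsPreconnected (Torus k m) (zariski (torusCoord k m)) (Set.range (cochar ν)) := by
  let := zariski (torusCoord k m)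
  have hcont : Continuous fun x : CofiniteTopology kˣ => cochar ν (CofiniteTopology.of.symm x) := by
    refine continuous_generateFrom_iff.2 ?_
    rintro _ ⟨f, hf, rfl⟩
    rw [CofiniteTopology.isOpen_iff']
    obtain ⟨n, p, hp⟩ := exists_polynomial_of_regular ν hf
    by_cases h0 : p = 0
    · left
      refine Set.eq_empty_of_forall_notMem fun x hx => hx ?_
      have := hp (CofiniteTopology.of.symm x)
      rw [h0, Polynomial.eval_zero] at this
      exact (mul_eq_zero.1 this).resolve_left (pow_ne_zero _ (Units.ne_zero _))
    · right
      refine Set.Finite.subset ((Polynomial.finite_setOfPred_isRoot h0).preimage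
        (f := fun x : CofiniteTopology kˣ => ((CofiniteTopology.of.symm x : kˣ) : k))
        fun x _ y _ h => ?_) fun x hx => ?_
      · exact CofiniteTopology.of.symm.injective (Units.ext h)
      · have hx' : f (cochar ν (CofiniteTopology.of.symm x)) = 0 := not_not.1 hx
        change p.eval _ = 0
        rw [← hp, hx', mul_zero]
  have huniv : IsPreconnected (Set.univ : Set (CofiniteTopology kˣ)) := by
    rintro U V hU hV - ⟨x, -, hx⟩ ⟨y, -, hy⟩
    rw [CofiniteTopology.isOpen_iff] at hU hV
    have hfin := (hU ⟨x, hx⟩).union (hV ⟨y, hy⟩)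
    rw [← Set.compl_inter] at hfin
    have : Infinite (CofiniteTopology kˣ) := Infinite.of_injective _ CofiniteTopology.of.injective
    obtain ⟨z, hz⟩ := hfin.infinite_compl.nonempty
    rw [compl_compl] at hz
    exact ⟨z, trivial, hz⟩
  have := huniv.image _ hcont.continuousOn
  rw [Set.image_univ] at this
  convert this using 1
  ext g
  exact ⟨fun ⟨t, ht⟩ => ⟨CofiniteTopology.of t, by simpa using ht⟩,
    fun ⟨x, hx⟩ => ⟨CofiniteTopology.of.symm x, hx⟩⟩

theorem isClosed_zeroLocus {f : Torus k m → k} (hf : f ∈ regular (torusCoord k m)) :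
    @IsClosed (Torus k m) (zariski (torusCoord k m)) {g | f g = 0} := by
  let := zariski (torusCoord k m)
  rw [← isOpen_compl_iff]
  exact TopologicalSpace.isOpen_generateFrom_of_mem ⟨f, hf, rfl⟩

/-- A regular character taking finitely many values on a connected set containing the identity is
trivial on it. -/
theorem charOf_eq_one_of_isPreconnected [CharZero k] {C : Set (Torus k m)}
    (hC : @IsPreconnected (Torus k m) (zariski (torusCoord k m)) C) (h1 : (1 : Torus k m) ∈ C)
    (e : Fin m → ℤ) {N : ℕ} (hN : 0 < N) (hpow : ∀ g ∈ C, charOf k e g ^ N = 1) :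
    ∀ g ∈ C, charOf k e g = 1 := by
  let := zariski (torusCoord k m)
  intro g hg
  by_contra hne
  set f : Torus k m → k := fun g => (charOf k e g : k)
  have hf : f ∈ regular (torusCoord k m) := charOf_mem_regular e
  -- By `f^N - 1 = (f - 1) ∑ f^i` the zero loci of the two factors cover `C`. If both meet `C` they
  -- have a common point, where the sum equals `N ≠ 0`.
  have h1' := isClosed_zeroLocus ((regular (torusCoord k m)).sub_mem hf (one_mem _))
  have h2' := isClosed_zeroLocus (Subalgebra.sum_mem (regular (torusCoord k m))
    (t := Finset.range N) fun i _ => Subalgebra.pow_mem _ hf i)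
  have hgeom : ∀ g ∈ C, (∑ i ∈ Finset.range N, f ^ i) g * (f - 1) g = 0 := by
    intro g hg
    have := congrArg Units.val (hpow g hg)
    rw [← Pi.mul_apply, geom_sum_mul]
    simpa [f, sub_eq_zero] using this
  obtain ⟨x, -, hx1, hx2⟩ := isPreconnected_closed_iff.1 hC _ _ h1' h2'
    (fun x hx => (mul_eq_zero.1 (hgeom x hx)).symm)
    ⟨1, h1, by simp [f]⟩
    ⟨g, hg, (mul_eq_zero.1 (hgeom g hg)).resolve_right fun h =>
      hne (Units.ext (sub_eq_zero.1 h))⟩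
  have hfx : f x = 1 := sub_eq_zero.1 hx1
  have : (∑ i ∈ Finset.range N, f ^ i) x = N := by simp [hfx]
  have hx2' : (∑ i ∈ Finset.range N, f ^ i) x = 0 := hx2
  rw [this] at hx2'
  exact hN.ne' (by exact_mod_cast hx2')

end TorusCharacters

/-! ### Separation from a lattice by an integral functional. -/

section IntegralDuality

/-- Integral vectors none of whose positive multiples lie in a lattice are separated from the
lattice by a single integral functional. -/
theorem exists_integral_functional {m r s : ℕ} (v : Fin r → Fin m → ℤ) (w : Fin s → Fin m → ℤ)
    (h : ∀ i, ¬ ∃ N : ℕ, 0 < N ∧ ∃ c : Fin s → ℤ, N • v i = ∑ j, c j • w j) :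
    ∃ ν : Fin m → ℤ, (∀ j, ∑ l, ν l * w j l = 0) ∧ ∀ i, ∑ l, ν l * v i l ≠ 0 := by
  let cast : (Fin m → ℤ) → Fin m → ℚ := fun x l => x l
  let U : Submodule ℚ (Fin m → ℚ) := Submodule.span ℚ (Set.range fun j => cast (w j))
  have hv : ∀ i, cast (v i) ∉ U := by
    intro i hi
    obtain ⟨q, hq⟩ := (Submodule.mem_span_range_iff_exists_fun ℚ).1 hi
    -- Clearing denominators turns a rational relation into an integral one; `d` may be negative,
    -- hence the factor `d.sign` below.
    obtain ⟨⟨d, hd⟩, hdq⟩ :=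
      IsLocalization.exist_integer_multiples_of_finite (nonZeroDivisors ℤ) q
    choose c hc using hdq
    have hd0 : d ≠ 0 := nonZeroDivisors.ne_zero hd
    refine h i ⟨d.natAbs, Int.natAbs_pos.2 hd0, fun j => d.sign * c j, ?_⟩
    have e : d • v i = ∑ j, c j • w j := by
      funext l
      have h1 := congrFun hq l
      have hc' : ∀ j, (c j : ℚ) = d * q j := fun j => by simpa using hc j
      simp only [Finset.sum_apply, Pi.smul_apply, smul_eq_mul, cast] at h1 ⊢
      have : ((d * v i l : ℤ) : ℚ) = ((∑ j, c j * w j l : ℤ) : ℚ) := by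
        push_cast
        rw [← h1, Finset.mul_sum]
        exact Finset.sum_congr rfl fun j _ => by rw [hc']; ring
      exact_mod_cast this
    have e2 : (d.natAbs • v i : Fin m → ℤ) = d.sign • d • v i := by
      rw [smul_smul, Int.sign_mul_self_eq_natAbs, natCast_zsmul]
    rw [e2, e, Finset.smul_sum]
    simp only [smul_smul]
  -- Working in the quotient by `U` makes the functional vanish on the `w j`; one functional can be
  -- nonzero on finitely many nonzero vectors at once.
  obtain ⟨f, hf⟩ := Module.exists_dual_forall_apply_ne_zero (K := ℚ)
    (fun i => U.mkQ (cast (v i))) fun i => by simpa using hv i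
  let F : Module.Dual ℚ (Fin m → ℚ) := f ∘ₗ U.mkQ
  obtain ⟨⟨d, hd⟩, hdF⟩ := IsLocalization.exist_integer_multiples_of_finite (nonZeroDivisors ℤ)
    fun l => F (Pi.single l 1)
  choose ν hν using hdF
  have hd0 : (d : ℚ) ≠ 0 := Int.cast_ne_zero.2 (nonZeroDivisors.ne_zero hd)
  have key : ∀ x : Fin m → ℤ, ((∑ l, ν l * x l : ℤ) : ℚ) = d * F (cast x) := by
    intro x
    have hν' : ∀ l, (ν l : ℚ) = d * F (Pi.single l 1) := fun l => by simpa using hν l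
    conv_rhs => rw [LinearMap.pi_apply_eq_sum_univ F (cast x)]
    push_cast
    rw [Finset.mul_sum]
    refine Finset.sum_congr rfl fun l _ => ?_
    have e : (fun j => if l = j then (1 : ℚ) else 0) = Pi.single l 1 := by
      funext j
      by_cases hj : l = j
      · subst hj; simp
      · simp [hj, Ne.symm hj]
    rw [hν', e, smul_eq_mul]
    ring
  refine ⟨ν, fun j => ?_, fun i h0 => ?_⟩
  · have h1 := key (w j)
    have h2 : U.mkQ (cast (w j)) = 0 := by
      rw [Submodule.mkQ_apply, Submodule.Quotient.mk_eq_zero]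
      exact Submodule.subset_span ⟨j, rfl⟩
    rw [LinearMap.comp_apply, h2, map_zero, mul_zero] at h1
    exact_mod_cast h1
  · have h1 := key (v i)
    rw [h0, Int.cast_zero] at h1
    exact hf i ((mul_eq_zero.1 h1.symm).resolve_left hd0)

end IntegralDuality

/-- Without finite dimensional simple modules `1` would annihilate all of them vacuously. -/
theorem HasEnoughSimpleFD.hasNonzeroFD {k R : Type u} [Field k] [Ring R] [Algebra k R]
    [Nontrivial R] (h : HasEnoughSimpleFD k R) : HasNonzeroFD k R := by
  by_contra hcon
  refine one_ne_zero (α := R) (h 1 fun M _ _ _ _ hM hfin => absurd ?_ hcon)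
  exact ⟨M, _, _, _, inferInstance, hfin, IsSimpleModule.nontrivial R M⟩

/-! ### Restriction to a torus and to one parameter subgroups. -/

section Restriction

variable {k : Type u} [Field k] {I : Type} [Fintype I]

theorem linearIndependent_of_restrict_torus [Infinite k] {X : Type u} {P : I → Prop}
    {F : orthant P → X → k} (emb : (I → kˣ) → X)
    (h : ∀ μ g, F μ (emb g) = (charOf k (μ : I → ℤ) g : k)) : LinearIndependent k F := by
  refine LinearIndependent.of_comp (LinearMap.funLeft k k emb) ?_
  have e : (LinearMap.funLeft k k emb) ∘ F =
      (fun (e : I → ℤ) (g : I → kˣ) => (charOf k e g : k)) ∘ Subtype.val := by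
    funext μ g
    exact h μ g
  rw [e]
  exact (linearIndependent_charOf k I).comp _ Subtype.val_injective

/-- The exponents of the monomials whose weight is trivial on `S`. -/
def weightKernel {T : Type u} (wt : I → T → kˣ) (S : Set T) : AddSubgroup (I → ℤ) where
  carrier := {l | ∀ t ∈ S, charOf k l (fun i => wt i t) = 1}
  zero_mem' t _ := charOf_zero _
  add_mem' h h' t ht := by rw [charOf_add, h t ht, h' t ht, one_mul]
  neg_mem' h t ht := by rw [charOf_neg, h t ht, inv_one]

theorem charOf_comp {m : ℕ} (l : I → ℤ) (E : I → Fin m → ℤ) (g : Torus k m) :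
    charOf k l (fun i => charOf k (E i) g) = charOf k (∑ i, l i • E i) g := by
  rw [charOf_sum, charOf_apply]

theorem sum_eq_zero_of_charOf_cochar [Infinite k] {m : ℕ} (l : I → ℤ) (E : I → Fin m → ℤ)
    (ν : Fin m → ℤ) (h : ∀ t : kˣ, charOf k l (fun i => charOf k (E i) (cochar ν t)) = 1) :
    ∑ i, (∑ p, ν p * E i p) * l i = 0 := by
  by_contra hne
  obtain ⟨t, ht⟩ := exists_zpow_ne_one (k := k) hne
  refine ht ?_
  rw [← h t, charOf_comp, charOf_cochar]
  congr 1
  simp only [Finset.sum_apply, Pi.smul_apply, smul_eq_mul, Finset.mul_sum, Finset.sum_mul]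
  rw [Finset.sum_comm]
  exact Finset.sum_congr rfl fun _ _ => Finset.sum_congr rfl fun _ _ => by ring

end Restriction

/-! ### The monomial basis and degree lattice for `V`. -/

section AffineSpace

variable (k : Type u) [Field k] (r : ℕ)

/-- The monomial functions on `k^r`. -/
def vMonomial (μ : orthant fun _ : Fin r => True) (v : Fin r → k) : k :=
  ∏ i, v i ^ ((μ : Fin r → ℤ) i).toNat

theorem vMonomial_zero : vMonomial k r 0 = 1 := by
  funext v; simp [vMonomial]

theorem vMonomial_add (μ ν) : vMonomial k r (μ + ν) = vMonomial k r μ * vMonomial k r ν := by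
  funext v
  simp only [vMonomial, Pi.mul_apply, ← Finset.prod_mul_distrib, ← pow_add]
  refine Finset.prod_congr rfl fun i _ => ?_
  rw [← Int.toNat_add (μ.2 i trivial) (ν.2 i trivial)]
  rfl

theorem vCoord_mem_range (i : Fin r) : vCoord k r i ∈ Set.range (vMonomial k r) := by
  refine ⟨⟨Pi.single i 1, single_mem_orthant i⟩, ?_⟩
  funext v
  simp only [vMonomial, vCoord]
  rw [Finset.prod_eq_single i (fun j _ hj => by simp [hj]) (by simp)]
  simp

theorem vMonomial_mem_regular (μ) : vMonomial k r μ ∈ regular (vCoord k r) := by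
  have : vMonomial k r μ = ∏ i, vCoord k r i ^ ((μ : Fin r → ℤ) i).toNat := by
    funext v; simp [vMonomial, vCoord, Finset.prod_apply]
  rw [this]
  exact Subalgebra.prod_mem _ fun i _ =>
    (regular (vCoord k r)).pow_mem (Algebra.subset_adjoin ⟨i, rfl⟩) _

theorem linearIndependent_vMonomial [Infinite k] : LinearIndependent k (vMonomial k r) := by
  refine linearIndependent_of_restrict_torus (fun g i => (g i : k)) fun μ g => ?_
  rw [charOf_apply, vMonomial, Units.coe_prod]
  refine Finset.prod_congr rfl fun i _ => ?_
  rw [← Units.val_pow_eq_pow_val, ← zpow_natCast, Int.toNat_of_nonneg (μ.2 i trivial)]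

variable [Infinite k]

/-- The monomial basis of `O(k^r)`. -/
def vBasis : Module.Basis (orthant fun _ : Fin r => True) k (RegularFunctions (vCoord k r)) :=
  monomialBasis (vMonomial_zero k r) (vMonomial_add k r) (vCoord_mem_range k r)
    (vMonomial_mem_regular k r) (linearIndependent_vMonomial k r)

theorem vBasis_val (μ) : (vBasis k r μ).1 = vMonomial k r μ := monomialBasis_val _ _ _ _ _ μ

theorem isMonomialBasis_vBasis : IsMonomialBasis (vBasis k r) := fun μ ν => by
  refine Subtype.ext ?_
  change _ = (vBasis k r μ).1 * (vBasis k r ν).1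
  rw [vBasis_val, vBasis_val, vBasis_val, vMonomial_add]

variable {k r}

theorem DiagonalAction.isDegreeLattice_V [CharZero k] {m s : ℕ} (a : DiagonalAction k m r s)
    (S : Set (Torus k m)) :
    IsDegreeLattice (vBasis k r) (a.translateV '' S)
      (weightKernel (fun i t => a.weightV i t) S) := by
  refine (isMonomialBasis_vBasis k r).isDegreeLattice S a.translateV
    (fun t μ => charOf k μ fun i => a.weightV i t) (fun t μ ν => charOf_add μ ν _)
    (fun t μ hμ => ?_) _ fun l => Iff.rfl
  have e : mon (vBasis k r) μ = vBasis k r ⟨μ, hμ⟩ := mon_coe (vBasis k r) ⟨μ, hμ⟩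
  rw [e]
  refine Subtype.ext (funext fun v => ?_)
  change (vBasis k r ⟨μ, hμ⟩).1 (a.actV t v) = _ * (vBasis k r ⟨μ, hμ⟩).1 v
  rw [vBasis_val]
  simp only [vMonomial, DiagonalAction.actV, mul_pow, Finset.prod_mul_distrib]
  rw [charOf_apply, Units.coe_prod]
  congr 1
  refine Finset.prod_congr rfl fun i _ => ?_
  rw [← Units.val_pow_eq_pow_val, ← zpow_natCast, Int.toNat_of_nonneg (hμ i trivial)]

end AffineSpace

/-! ### The monomial basis and degree lattice for `Y`. -/

section AffineSpaceTimesTorus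

variable (k : Type u) [Field k] (r s : ℕ)

/-- The monomial functions on `k^r × (kˣ)^s`. -/
def yMonomial (μ : orthant fun i : Fin r ⊕ Fin s => i.isLeft = true) (y : YPoints k r s) : k :=
  (∏ i, y.1 i ^ ((μ : Fin r ⊕ Fin s → ℤ) (Sum.inl i)).toNat) *
    (charOf k (fun j => (μ : Fin r ⊕ Fin s → ℤ) (Sum.inr j)) y.2 : k)

theorem yMonomial_zero : yMonomial k r s 0 = 1 := by
  funext y; simp [yMonomial, charOf_apply]

theorem yMonomial_add (μ ν) :
    yMonomial k r s (μ + ν) = yMonomial k r s μ * yMonomial k r s ν := by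
  funext y
  have h1 : ∏ i, y.1 i ^ ((μ + ν).1 (Sum.inl i)).toNat =
      (∏ i, y.1 i ^ (μ.1 (Sum.inl i)).toNat) * ∏ i, y.1 i ^ (ν.1 (Sum.inl i)).toNat := by
    rw [← Finset.prod_mul_distrib]
    refine Finset.prod_congr rfl fun i _ => ?_
    rw [← pow_add, ← Int.toNat_add (μ.2 (Sum.inl i) rfl) (ν.2 (Sum.inl i) rfl)]
    rfl
  have h2 : (fun j => (μ + ν).1 (Sum.inr j)) =
      (fun j => μ.1 (Sum.inr j)) + fun j => ν.1 (Sum.inr j) := rfl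
  simp only [yMonomial, Pi.mul_apply]
  rw [h1, h2, charOf_add, Units.val_mul]
  ring

theorem yCoord_mem_range (i : Fin r ⊕ (Fin s ⊕ Fin s)) :
    yCoord k r s i ∈ Set.range (yMonomial k r s) := by
  rcases i with i | j | j
  · refine ⟨⟨Pi.single (Sum.inl i) 1, single_mem_orthant _⟩, ?_⟩
    funext y
    simp only [yMonomial, yCoord]
    rw [Finset.prod_eq_single i (fun l _ hl => by simp [hl]) (by simp)]
    simp [charOf_apply]
  · refine ⟨⟨Pi.single (Sum.inr j) 1, single_mem_orthant _⟩, ?_⟩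
    funext y
    simp only [yMonomial, yCoord, charOf_apply]
    rw [Finset.prod_eq_single j (fun l _ hl => by simp [hl]) (by simp)]
    simp
  · refine ⟨⟨Pi.single (Sum.inr j) (-1), ?_⟩, ?_⟩
    · rintro (l | l) hl
      · simp
      · simp at hl
    funext y
    simp only [yMonomial, yCoord, charOf_apply]
    rw [Finset.prod_eq_single j (fun l _ hl => by simp [hl]) (by simp)]
    simp

theorem charOf_snd_mem_regular (e : Fin s → ℤ) :
    (fun y : YPoints k r s => (charOf k e y.2 : k)) ∈ regular (yCoord k r s) := by
  have h : (fun y : YPoints k r s => (charOf k e y.2 : k)) =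
      ∏ i, fun y : YPoints k r s => ((y.2 i ^ e i : kˣ) : k) := by
    funext g
    simp [charOf_apply, Finset.prod_apply]
  rw [h]
  refine Subalgebra.prod_mem _ fun i _ => ?_
  obtain ⟨n, hn | hn⟩ := Int.eq_nat_or_neg (e i)
  · have : (fun y : YPoints k r s => ((y.2 i ^ e i : kˣ) : k)) =
        yCoord k r s (Sum.inr (Sum.inl i)) ^ n := by
      funext g; simp [hn, yCoord]
    rw [this]
    exact (regular (yCoord k r s)).pow_mem (Algebra.subset_adjoin ⟨_, rfl⟩) n
  · have : (fun y : YPoints k r s => ((y.2 i ^ e i : kˣ) : k)) =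
        yCoord k r s (Sum.inr (Sum.inr i)) ^ n := by
      funext g; simp [hn, yCoord]
    rw [this]
    exact (regular (yCoord k r s)).pow_mem (Algebra.subset_adjoin ⟨_, rfl⟩) n

theorem yMonomial_mem_regular (μ) : yMonomial k r s μ ∈ regular (yCoord k r s) := by
  have : yMonomial k r s μ =
      (∏ i, yCoord k r s (Sum.inl i) ^ ((μ : Fin r ⊕ Fin s → ℤ) (Sum.inl i)).toNat) *
      fun y => (charOf k (fun j => (μ : Fin r ⊕ Fin s → ℤ) (Sum.inr j)) y.2 : k) := by
    funext v; simp [yMonomial, yCoord, Finset.prod_apply]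
  rw [this]
  exact (regular (yCoord k r s)).mul_mem (Subalgebra.prod_mem _ fun i _ =>
    (regular (yCoord k r s)).pow_mem (Algebra.subset_adjoin ⟨_, rfl⟩) _)
    (charOf_snd_mem_regular k r s _)

theorem linearIndependent_yMonomial [Infinite k] : LinearIndependent k (yMonomial k r s) := by
  refine linearIndependent_of_restrict_torus
    (fun g => (fun i => (g (Sum.inl i) : k), fun j => g (Sum.inr j))) fun μ g => ?_
  rw [charOf_apply, yMonomial, Fintype.prod_sum_type, Units.val_mul, Units.coe_prod, charOf_apply]
  congr 1
  refine Finset.prod_congr rfl fun i _ => ?_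
  rw [← Units.val_pow_eq_pow_val, ← zpow_natCast, Int.toNat_of_nonneg (μ.2 (Sum.inl i) rfl)]

variable [Infinite k]

/-- The monomial basis of `O(k^r × (kˣ)^s)`. -/
def yBasis : Module.Basis (orthant fun i : Fin r ⊕ Fin s => i.isLeft = true) k
    (RegularFunctions (yCoord k r s)) :=
  monomialBasis (yMonomial_zero k r s) (yMonomial_add k r s) (yCoord_mem_range k r s)
    (yMonomial_mem_regular k r s) (linearIndependent_yMonomial k r s)

theorem yBasis_val (μ) : (yBasis k r s μ).1 = yMonomial k r s μ := monomialBasis_val _ _ _ _ _ μ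

theorem isMonomialBasis_yBasis : IsMonomialBasis (yBasis k r s) := fun μ ν => by
  refine Subtype.ext ?_
  change _ = (yBasis k r s μ).1 * (yBasis k r s ν).1
  rw [yBasis_val, yBasis_val, yBasis_val, yMonomial_add]

variable {k r s}

/-- The weights of the action on `Y`. -/
def DiagonalAction.weightY {m : ℕ} (a : DiagonalAction k m r s) (i : Fin r ⊕ Fin s)
    (t : Torus k m) : kˣ := Sum.elim (fun i => a.weightV i t) (fun j => a.weightW j t) i

theorem DiagonalAction.isDegreeLattice_Y [CharZero k] {m : ℕ} (a : DiagonalAction k m r s)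
    (S : Set (Torus k m)) :
    IsDegreeLattice (yBasis k r s) (a.translateY '' S) (weightKernel a.weightY S) := by
  refine (isMonomialBasis_yBasis k r s).isDegreeLattice S a.translateY
    (fun t μ => charOf k μ fun i => a.weightY i t) (fun t μ ν => charOf_add μ ν _)
    (fun t μ hμ => ?_) _ fun l => Iff.rfl
  have e : mon (yBasis k r s) μ = yBasis k r s ⟨μ, hμ⟩ := mon_coe (yBasis k r s) ⟨μ, hμ⟩
  rw [e]
  refine Subtype.ext (funext fun y => ?_)
  change (yBasis k r s ⟨μ, hμ⟩).1 (a.actY t y) = _ * (yBasis k r s ⟨μ, hμ⟩).1 y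
  rw [yBasis_val]
  have h1 : charOf k (fun j => μ (Sum.inr j)) (a.actW t y.2) =
      charOf k (fun j => μ (Sum.inr j)) (fun j => a.weightW j t) *
      charOf k (fun j => μ (Sum.inr j)) y.2 := by
    rw [← map_mul]; rfl
  have h2 : ∏ i, a.actV t y.1 i ^ (μ (Sum.inl i)).toNat =
      ((∏ i, a.weightV i t ^ μ (Sum.inl i) : kˣ) : k) *
        ∏ i, y.1 i ^ (μ (Sum.inl i)).toNat := by
    simp only [DiagonalAction.actV, mul_pow, Finset.prod_mul_distrib]
    rw [Units.coe_prod]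
    congr 1
    refine Finset.prod_congr rfl fun i _ => ?_
    rw [← Units.val_pow_eq_pow_val, ← zpow_natCast, Int.toNat_of_nonneg (hμ (Sum.inl i) rfl)]
  have h3 : charOf k μ (fun i => a.weightY i t) = (∏ i, a.weightV i t ^ μ (Sum.inl i)) *
      charOf k (fun j => μ (Sum.inr j)) (fun j => a.weightW j t) := by
    rw [charOf_apply, Fintype.prod_sum_type]; rfl
  simp only [yMonomial, DiagonalAction.actY]
  rw [h1, h2, h3, Units.val_mul, Units.val_mul]
  ring

end AffineSpaceTimesTorus

/-! ### Weights on the identity component of the stabilizer. -/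

section IdentityComponent

variable {k : Type u} [Field k] {m r s : ℕ} (a : DiagonalAction k m r s) (w : Fin s → kˣ)

theorem DiagonalAction.mem_stabilizer {g : Torus k m} :
    g ∈ a.stabilizer w ↔ ∀ j, a.weightW j g = 1 := by
  change a.actW g w = w ↔ _
  rw [funext_iff]
  simp [DiagonalAction.actW]

theorem DiagonalAction.fixedV_eq_bot_iff (S : Set (Torus k m)) :
    a.fixedV S = ⊥ ↔ ∀ i, ∃ g ∈ S, a.weightV i g ≠ 1 := by
  rw [Submodule.eq_bot_iff]
  constructor
  · intro h i
    by_contra! hcon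
    have := h (Pi.single i 1) fun g hg => by
      funext j
      by_cases hj : j = i
      · subst hj; simp [DiagonalAction.actV, hcon g hg]
      · simp [DiagonalAction.actV, hj]
    simpa using congrFun this i
  · intro h v hv
    funext i
    obtain ⟨g, hg, hne⟩ := h i
    have := congrFun (hv g hg) i
    by_contra h0
    exact hne (Units.ext (mul_right_cancel₀ h0 (this.trans (one_mul _).symm)))

variable [CharZero k] {E : Fin r → Fin m → ℤ} {E' : Fin s → Fin m → ℤ}
  (hE : ∀ i, a.weightV i = charOf k (E i)) (hE' : ∀ j, a.weightW j = charOf k (E' j))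
include hE'

theorem DiagonalAction.cochar_mem_stabilizerIdentityComponent (ν : Fin m → ℤ)
    (hν : ∀ j, ∑ l, ν l * E' j l = 0) (t : kˣ) :
    cochar ν t ∈ a.stabilizerIdentityComponent w := by
  let _ := zariski (torusCoord k m)
  refine (isPreconnected_range_cochar ν).subset_connectedComponentIn ⟨1, ?_⟩ ?_ ⟨t, rfl⟩
  · funext i; simp [cochar]
  · rintro _ ⟨t, rfl⟩
    refine (a.mem_stabilizer w).2 fun j => ?_
    rw [hE', charOf_cochar, hν, zpow_zero]

include hE

/-- A weight is trivial on the identity component of the stabilizer precisely if a positive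
multiple of its exponent is in the lattice generated by the exponents of the weights on `W`. -/
theorem DiagonalAction.weightV_trivial_iff (i : Fin r) :
    (∀ g ∈ a.stabilizerIdentityComponent w, a.weightV i g = 1) ↔
      ∃ N : ℕ, 0 < N ∧ ∃ c : Fin s → ℤ, N • E i = ∑ j, c j • E' j := by
  constructor
  · intro h
    by_contra hcon
    -- The resulting one parameter subgroup is connected and fixes `w`, so it lies in `H°`, yet the
    -- weight is not trivial on it.
    obtain ⟨ν, hν, hν'⟩ := exists_integral_functional (fun _ : Fin 1 => E i) E' fun _ => hcon
    obtain ⟨t, ht⟩ := exists_zpow_ne_one (k := k) (hν' 0)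
    refine ht ?_
    rw [← charOf_cochar, ← hE]
    exact h _ (a.cochar_mem_stabilizerIdentityComponent w hE' ν hν t)
  · rintro ⟨N, hN, c, hc⟩
    rw [hE]
    let _ := zariski (torusCoord k m)
    refine charOf_eq_one_of_isPreconnected isPreconnected_connectedComponentIn
      (mem_connectedComponentIn (one_mem (a.stabilizer w))) (E i) hN fun g hg => ?_
    -- On the whole stabilizer the `N`-th power of the weight is a product of powers of trivial
    -- weights on `W`.
    have hg' := (a.mem_stabilizer w).1 (connectedComponentIn_subset _ _ hg)
    rw [← charOf_nsmul, hc, charOf_sum]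
    exact Finset.prod_eq_one fun j _ => by rw [← hE', hg' j, one_zpow]

end IdentityComponent

end TorusDiff

end

/-! ### The equivalence of the four conditions. -/

theorem theoremB {k : Type u} [Field k] [IsAlgClosed k] [CharZero k] {m r s : ℕ}
    (a : TorusDiff.DiagonalAction k m r s) (htrans : a.TransitiveOnW) (w : Fin s → kˣ) :
    List.TFAE
      [a.fixedV (a.stabilizerIdentityComponent w) = ⊥,
        TorusDiff.HasEnoughSimpleFD k (a.diffOpsV (a.stabilizerIdentityComponent w)),
        TorusDiff.HasNonzeroFD k (a.diffOpsY Set.univ),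
        TorusDiff.HasEnoughSimpleFD k (a.diffOpsY Set.univ)] := by
  open TorusDiff in
  choose E hE using fun i => exists_eq_charOf _ (a.regularV i)
  choose E' hE' using fun j => exists_eq_charOf _ (a.regularW j)
  have triv := a.weightV_trivial_iff w hE hE'
  have hbV := isMonomialBasis_vBasis k r
  have hbY := isMonomialBasis_yBasis k r s
  have hV := a.isDegreeLattice_V (a.stabilizerIdentityComponent w)
  have hY := a.isDegreeLattice_Y Set.univ
  have hfix := a.fixedV_eq_bot_iff (a.stabilizerIdentityComponent w)
  have hν : a.fixedV (a.stabilizerIdentityComponent w) = ⊥ → ∃ ν : Fin m → ℤ,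
      (∀ j, ∑ l, ν l * E' j l = 0) ∧ ∀ i, ∑ l, ν l * E i l ≠ 0 := by
    intro h
    refine exists_integral_functional E E' fun i hi => ?_
    obtain ⟨g, hg, hne⟩ := hfix.1 h i
    exact hne ((triv i).2 hi g hg)
  have : Nontrivial (RegularFunctions (vCoord k r)) := nontrivial_of_ne _ _ ((vBasis k r).ne_zero 0)
  have : Nontrivial (RegularFunctions (yCoord k r s)) :=
    nontrivial_of_ne _ _ ((yBasis k r s).ne_zero 0)
  tfae_have 1 → 2 := by
    intro h
    obtain ⟨ν, hν0, hν1⟩ := hν h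
    refine hbV.hasEnoughSimpleFD hV (fun i => ∑ l, ν l * E i l) (fun i _ => hν1 i)
      (fun i hi => absurd trivial hi) (fun l hl => ?_) (fun l _ hl => funext fun i => hl i trivial)
    refine sum_eq_zero_of_charOf_cochar (k := k) l E ν fun t => ?_
    have := hl _ (a.cochar_mem_stabilizerIdentityComponent w hE' ν hν0 t)
    simpa only [hE] using this
  tfae_have 2 → 1 := by
    intro h
    rw [hfix]
    by_contra! hcon
    obtain ⟨i, hi⟩ := hcon
    -- A trivial weight makes the coordinate `x_i` itself invariant, so the ladder has `N = 1`.
    refine hbV.not_hasNonzeroFD hV (Pi.single i 1) (fun t ht => ?_) i trivial (by simp)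
      (fun j _ hj => by simp [hj]) h.hasNonzeroFD
    rw [charOf_single]
    beta_reduce
    rw [hi t ht, one_zpow]
  tfae_have 1 → 4 := by
    intro h
    obtain ⟨ν, hν0, hν1⟩ := hν h
    refine hbY.hasEnoughSimpleFD hY (fun i => ∑ l, ν l * Sum.elim E E' i l) ?_ ?_
      (fun l hl => ?_) (fun l hl hl0 => ?_)
    · rintro (i | j) hi
      · exact hν1 i
      · simp at hi
    · rintro (i | j) hi
      · simp at hi
      · exact hν0 j
    · refine sum_eq_zero_of_charOf_cochar (k := k) l (Sum.elim E E') ν fun t => ?_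
      rw [← hl (cochar ν t) trivial]
      congr 1
      funext i
      rcases i with i | j <;> simp [DiagonalAction.weightY, hE, hE']
    -- Transitivity enters here: the weights on `W` map `G` onto the torus `W`, so a character of
    -- `W` that is trivial on `G` has exponent zero.
    · have hr : (fun j => l (Sum.inr j)) = 0 := by
        refine charOf_injective (k := k) (MonoidHom.ext fun v => ?_)
        obtain ⟨g, hg⟩ := htrans 1 v
        have h1 := hl g trivial
        rw [charOf_apply, Fintype.prod_sum_type,
          Finset.prod_eq_one (fun i _ => by rw [hl0 _ rfl, zpow_zero]), one_mul] at h1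
        rw [charOf_zero, ← h1, charOf_apply]
        refine Finset.prod_congr rfl fun j _ => ?_
        rw [← hg]
        simp [DiagonalAction.weightY, DiagonalAction.actW]
      funext i
      rcases i with i | j
      · exact hl0 _ rfl
      · exact congrFun hr j
  tfae_have 4 → 3 := fun h => h.hasNonzeroFD
  tfae_have 3 → 1 := by
    intro h
    rw [hfix]
    by_contra! hcon
    obtain ⟨i, hi⟩ := hcon
    obtain ⟨N, hN, c, hc⟩ := (triv i).1 hi
    -- The relation `N • E i = ∑ c j • E' j` says that `x_i^N` times the Laurent monomial on `W`
    -- with exponents `-c` is `G`-invariant.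
    refine hbY.not_hasNonzeroFD hY (Sum.elim (Pi.single i (N : ℤ)) (-c)) (fun t _ => ?_)
      (Sum.inl i) rfl (by simpa using hN) ?_ h
    · have hsplit : charOf k (Sum.elim (Pi.single i (N : ℤ)) (-c)) (fun i => a.weightY i t) =
          charOf k (Pi.single i (N : ℤ)) (fun i => charOf k (E i) t) *
          charOf k (-c) (fun j => charOf k (E' j) t) := by
        rw [charOf_apply, Fintype.prod_sum_type]
        simp only [DiagonalAction.weightY, Sum.elim_inl, Sum.elim_inr, hE, hE']
        rfl
      rw [hsplit, charOf_single, charOf_neg, charOf_comp, ← hc, charOf_nsmul, zpow_natCast,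
        mul_inv_cancel]
    · rintro (j | j) hj hne
      · have : j ≠ i := fun h => hne (h ▸ rfl)
        simp [this]
      · simp at hj
  tfae_finish
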